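/- Let $K$ be a field with $\operatorname{char} K\neq 2$, let $X=\{x_1,x_2,\ldots\}$ be a finite or countably infinite set with more than one element, and let $K\langle X\rangle$ be the free unitary associative $K$-algebra on $X$, with $[f,g]=fg-gf$. Order the words in $X$ by deg-lex: first by length, then lexicographically from left to right with $x_1<x_2<\cdots$; let $\mathrm{lt}(f)$ be the greatest word occurring in $f\neq 0$. Let $T$ be the T-ideal of $K\langle X\rangle$ generated by $[x_1,x_2,x_3]=[[x_1,x_2],x_3]$, i.e. the two-sided ideal generated by all $[[p,q],r]$ with $p,q,r\in K\langle X\rangle$. A set $G\subseteq T$ is a Gröbner basis of $T$ if for every nonzero $f\in T$ there is $g\in G$ such that $\mathrm{lt}(g)$ is a subword (contiguous factor) of $\mathrm{lt}(f)$; it is minimal if for every $g\in G$ the set $G\setminus\{g\}$ is not a Gröbner basis of $T$. Theorem. The set of all of the following polynomials, with all indices running over the indices of elements of $X$, is a minimal Gröbner basis of $T$ with respect to the deg-lex ordering: \[ f'_{ij}=[[x_i,x_j],x_j],\quad f''_{ij}=[x_i,[x_i,x_j]],\quad t_{ij}=[x_i,x_j][x_i,x_j]\qquad (i>j); \] \[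 g'_{ijk}=[x_i,[x_j,x_k]],\quad g''_{ikj}=[[x_i,x_k],x_j],\quad u'_{ijk}=[x_i,x_j][x_i,x_k],\quad u''_{ijk}=[x_i,x_k][x_i,x_j]\qquad (i>j>k); \] \[ v'_{ijka}=[x_j,x_k]\,x_j^{a_j}\cdots x_{i-1}^{a_{i-1}}\,[x_i,x_k],\quad v''_{ijka}=[x_j,x_k]\,x_j^{a_j}\cdots x_{i-1}^{a_{i-1}}\,[x_i,x_j] \qquad (i>j>k,\ a_j,\ldots,a_{i-1}\ge 0); \] \[ w'_{ijkla}=[x_j,x_k]\,x_j^{a_j}\cdots x_{i-1}^{a_{i-1}}\,[x_i,x_l]+[x_j,x_l]\,x_j^{a_j}\cdots x_{i-1}^{a_{i-1}}\,[x_i,x_k], \] \[ w''_{ijkla}=[x_j,x_l]\,x_j^{a_j}\cdots x_{i-1}^{a_{i-1}}\,[x_i,x_k]+[x_k,x_l]\,x_j^{a_j}\cdots x_{i-1}^{a_{i-1}}\,[x_i,x_j] \qquad (i>j>k>l,\ a_j,\ldots,a_{i-1}\ge 0). \] -/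

import Mathlib

noncomputable section

namespace TIdealGroebner

/-- The free unitary associative algebra `K⟨X⟩`, `X = {x i | i : ι}`: the formal `K`-linear
combinations of words in the letters `ι`, multiplied by concatenation. -/
abbrev FreeAlg (K ι : Type*) [Field K] : Type _ := MonoidAlgebra K (FreeMonoid ι)

/-- The free generator with index `i`. -/
def x (K : Type*) [Field K] {ι : Type*} (i : ι) : FreeAlg K ι :=
  MonoidAlgebra.of K (FreeMonoid ι) (FreeMonoid.of i)

/-! ### Words, leading words, Gröbner bases -/

/-- The strict deg-lex order on words: first by length, then lexicographically from the left. -/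
def DegLexLT {ι : Type*} [LinearOrder ι] (u v : FreeMonoid ι) : Prop :=
  List.Shortlex (· < ·) u.toList v.toList

/-- `u` is a subword (a factor) of `w`. -/
def IsSubword {ι : Type*} (u w : FreeMonoid ι) : Prop :=
  ∃ a b : FreeMonoid ι, w = a * u * b

/-- `w` is the leading word of `f` for the strict order `r`: the greatest of the words that occur
in `f` with a nonzero coefficient. The zero polynomial has no leading word. -/
def IsLeadingWord {K ι : Type*} [Field K] (r : FreeMonoid ι → FreeMonoid ι → Prop)
    (f : FreeAlg K ι) (w : FreeMonoid ι) : Prop :=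
  w ∈ f.coeff.support ∧ ∀ v ∈ f.coeff.support, v ≠ w → r v w

/-- `G` is a Gröbner basis of the two-sided ideal `I` for the strict word order `r`: `G ⊆ I`, and
for each nonzero `f ∈ I` the leading word of some `g ∈ G` is a subword of the leading
word of `f`. -/
def IsGroebnerBasis {K ι : Type*} [Field K] (r : FreeMonoid ι → FreeMonoid ι → Prop)
    (G : Set (FreeAlg K ι)) (I : TwoSidedIdeal (FreeAlg K ι)) : Prop :=
  (∀ g ∈ G, g ∈ I) ∧
    ∀ f ∈ I, f ≠ 0 → ∃ g ∈ G, ∃ u w : FreeMonoid ι,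
      IsLeadingWord r g u ∧ IsLeadingWord r f w ∧ IsSubword u w

/-- A Gröbner basis is minimal if it stops being a Gröbner basis when any one of its elements
is removed. -/
def IsMinimalGroebnerBasis {K ι : Type*} [Field K] (r : FreeMonoid ι → FreeMonoid ι → Prop)
    (G : Set (FreeAlg K ι)) (I : TwoSidedIdeal (FreeAlg K ι)) : Prop :=
  IsGroebnerBasis r G I ∧ ∀ g ∈ G, ¬ IsGroebnerBasis r (G \ {g}) I

/-! ### T-ideals -/

/-- The T-ideal of `K⟨X⟩` generated by a set `U` of polynomials in the variables `x 0, x 1, …`: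
the two-sided ideal generated by all values `u(f₀, f₁, …)` with `u ∈ U` and `fₙ ∈ K⟨X⟩`.
A homomorphism `φ` is the same as a substitution `x n ↦ fₙ`. The variables of the identities are
kept apart from `X`, so that an identity may involve more variables than `X` has elements. -/
def tIdeal {K : Type*} [Field K] (ι : Type*) (U : Set (FreeAlg K ℕ)) :
    TwoSidedIdeal (FreeAlg K ι) :=
  TwoSidedIdeal.span {p | ∃ φ : FreeAlg K ℕ →ₐ[K] FreeAlg K ι, ∃ u ∈ U, p = φ u}

/-! ### The polynomials. Here `⁅p, q⁆ = p * q - q * p`. -/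

section Polynomials

variable (K : Type*) [Field K] {ι : Type*}

/-- `f'_{ij} = [[x_i, x_j], x_j]` -/
def f₁ (i j : ι) : FreeAlg K ι := ⁅⁅x K i, x K j⁆, x K j⁆

/-- `f''_{ij} = [x_i, [x_i, x_j]]` -/
def f₂ (i j : ι) : FreeAlg K ι := ⁅x K i, ⁅x K i, x K j⁆⁆

/-- `g'_{ijk} = [x_i, [x_j, x_k]]` -/
def g₁ (i j k : ι) : FreeAlg K ι := ⁅x K i, ⁅x K j, x K k⁆⁆

/-- `g''_{ikj} = [[x_i, x_k], x_j]` (the arguments are in the order `i k j`) -/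
def g₂ (i k j : ι) : FreeAlg K ι := ⁅⁅x K i, x K k⁆, x K j⁆

/-- `t_{ij} = [x_i, x_j] [x_i, x_j]` -/
def t (i j : ι) : FreeAlg K ι := ⁅x K i, x K j⁆ * ⁅x K i, x K j⁆

/-- `u'_{ijk} = [x_i, x_j] [x_i, x_k]` -/
def u₁ (i j k : ι) : FreeAlg K ι := ⁅x K i, x K j⁆ * ⁅x K i, x K k⁆

/-- `u''_{ijk} = [x_i, x_k] [x_i, x_j]` -/
def u₂ (i j k : ι) : FreeAlg K ι := ⁅x K i, x K k⁆ * ⁅x K i, x K j⁆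

variable [LinearOrder ι] [LocallyFiniteOrder ι]

/-- The monomial `x_j ^ a_j ⋯ x_{i-1} ^ a_{i-1}`: the product of the powers `x_p ^ a_p`
over `j ≤ p < i`, in increasing order of `p`. -/
def mid (i j : ι) (a : ι → ℕ) : FreeAlg K ι :=
  (((Finset.Ico j i).sort (· ≤ ·)).map fun p => x K p ^ a p).prod

/-- `v'_{ijka} = [x_j, x_k] x_j ^ a_j ⋯ x_{i-1} ^ a_{i-1} [x_i, x_k]` -/
def v₁ (i j k : ι) (a : ι → ℕ) : FreeAlg K ι :=
  ⁅x K j, x K k⁆ * mid K i j a * ⁅x K i, x K k⁆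

/-- `v''_{ijka} = [x_j, x_k] x_j ^ a_j ⋯ x_{i-1} ^ a_{i-1} [x_i, x_j]` -/
def v₂ (i j k : ι) (a : ι → ℕ) : FreeAlg K ι :=
  ⁅x K j, x K k⁆ * mid K i j a * ⁅x K i, x K j⁆

/-- `w'_{ijkla} = [x_j, x_k] x_j ^ a_j ⋯ x_{i-1} ^ a_{i-1} [x_i, x_l]
+ [x_j, x_l] x_j ^ a_j ⋯ x_{i-1} ^ a_{i-1} [x_i, x_k]` -/
def w₁ (i j k l : ι) (a : ι → ℕ) : FreeAlg K ι :=
  ⁅x K j, x K k⁆ * mid K i j a * ⁅x K i, x K l⁆ + ⁅x K j, x K l⁆ * mid K i j a * ⁅x K i, x K k⁆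

/-- `w''_{ijkla} = [x_j, x_l] x_j ^ a_j ⋯ x_{i-1} ^ a_{i-1} [x_i, x_k]
+ [x_k, x_l] x_j ^ a_j ⋯ x_{i-1} ^ a_{i-1} [x_i, x_j]` -/
def w₂ (i j k l : ι) (a : ι → ℕ) : FreeAlg K ι :=
  ⁅x K j, x K l⁆ * mid K i j a * ⁅x K i, x K k⁆ + ⁅x K k, x K l⁆ * mid K i j a * ⁅x K i, x K j⁆

end Polynomials

end TIdealGroebner

end

open TIdealGroebner

/-! The upper bound on leading words comes from a model of the identity. Send `x_i` to `1 + e_i` in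
an exterior algebra, and record the multiset of letters of each word as a degree. Commuting two
letters costs the central factor `1 + 2 e_i e_j`, and triple commutators vanish (`lie_lie_wordVal`,
`lie_lie_gradedVal`), so `T` lies in the kernel. Sorting a word turns its value into a unit that
depends only on the multiset, times the product of the factors `1 + 2 e_i e_j` over its inverted
pairs (`wordVal_eq`). Hence, for `f ∈ T`, these inversion products, weighted by the coefficients of
`f`, sum to zero over each class of rearrangements (`sum_smul_invProd_eq_zero`).

Suppose the leading word `w` of `f` avoids all leading words of the basis. It is then an increasing
word with separated descents `T b` inserted (`AvoidsLeads.exists_normalWord`). Let the letters of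
these descents go to the standard basis of `K ^ n` and all others to zero. The inversion product of
`w` has top coefficient `2 ^ |P|`, with `P` the list of descents, which is nonzero since `char K ≠
2`. A smaller rearrangement leaves some descent letter uninverted with the others
(`NormalWord.exists_not_inverted`), so its product misses a basis vector and has top coefficient
zero. The relation then kills the coefficient of `w`, a contradiction
(`not_normalWord_of_isLeadingWord`).

The polynomials lie in `T` because modulo `T` commutators are central and `[a,c][b,d] + [a,d][b,c] =
0`. Minimality holds because no leading word of the basis contains that of another element
(`IsBasisElement.eq_of_infix`). -/

namespace TIdealGroebner

/-! ### Words in the letters `1 + e_i` of an exterior algebra. -/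

section Grassmann

variable {K V ι : Type*} [Field K] [AddCommGroup V] [Module K V]

/-- A product of two vectors is central in the exterior algebra. -/
theorem commute_ι_mul_ι (u v : V) (a : ExteriorAlgebra K V) :
    Commute (ExteriorAlgebra.ι K u * ExteriorAlgebra.ι K v) a := by
  induction a using ExteriorAlgebra.induction with
  | algebraMap r => exact Algebra.commutes' r _ |>.symm
  | ι z =>
    have h1 := eq_neg_of_add_eq_zero_left (ExteriorAlgebra.ι_add_mul_swap (R := K) v z)
    have h2 := eq_neg_of_add_eq_zero_left (ExteriorAlgebra.ι_add_mul_swap (R := K) u z)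
    rw [Commute, SemiconjBy, mul_assoc, h1, mul_neg, ← mul_assoc, h2]
    noncomm_ring
  | mul a b ha hb => exact ha.mul_right hb
  | add a b ha hb => exact ha.add_right hb

theorem commute_one_add_two_mul (u v : V) (a : ExteriorAlgebra K V) :
    Commute (1 + 2 * (ExteriorAlgebra.ι K u * ExteriorAlgebra.ι K v)) a := by
  refine (Commute.one_left a).add_left ?_
  rw [two_mul]
  exact (commute_ι_mul_ι u v a).add_left (commute_ι_mul_ι u v a)

theorem ι_mul_comm (u v : V) :
    ExteriorAlgebra.ι K u * ExteriorAlgebra.ι K v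
      = -(ExteriorAlgebra.ι K v * ExteriorAlgebra.ι K u) :=
  eq_neg_of_add_eq_zero_left (ExteriorAlgebra.ι_add_mul_swap u v)

/-- `(u v) (u' v) = 0` in the exterior algebra. -/
theorem ι_mul_ι_mul_right (u u' v : V) :
    ExteriorAlgebra.ι K u * ExteriorAlgebra.ι K v
      * (ExteriorAlgebra.ι K u' * ExteriorAlgebra.ι K v) = 0 := by
  rw [ι_mul_comm u' v, mul_neg, mul_assoc, ← mul_assoc (ExteriorAlgebra.ι K v),
    ExteriorAlgebra.ι_sq_zero]
  simp

theorem ι_mul_ι_mul_left (u v v' : V) :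
    ExteriorAlgebra.ι K u * ExteriorAlgebra.ι K v
      * (ExteriorAlgebra.ι K u * ExteriorAlgebra.ι K v') = 0 := by
  rw [ι_mul_comm u v, neg_mul, mul_assoc, ← mul_assoc (ExteriorAlgebra.ι K u),
    ExteriorAlgebra.ι_sq_zero]
  simp

variable (K) (e : ι → V)

/-- The value `1 + e i` of a letter in the exterior algebra. -/
def letterVal (i : ι) : ExteriorAlgebra K V := 1 + ExteriorAlgebra.ι K (e i)

/-- The product of the values of the letters of a word. -/
def wordVal (l : List ι) : ExteriorAlgebra K V := (l.map (letterVal K e)).prod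

@[simp] theorem wordVal_nil : wordVal K e [] = 1 := rfl

@[simp] theorem wordVal_cons (i : ι) (l : List ι) :
    wordVal K e (i :: l) = letterVal K e i * wordVal K e l := by
  simp [wordVal]

theorem wordVal_append (l l' : List ι) :
    wordVal K e (l ++ l') = wordVal K e l * wordVal K e l' := by
  simp [wordVal]

theorem letterVal_mul_letterVal (i j : ι) :
    letterVal K e i * letterVal K e j = letterVal K e j * letterVal K e i *
      (1 + 2 * (ExteriorAlgebra.ι K (e i) * ExteriorAlgebra.ι K (e j))) := by
  have h : ∀ a : ExteriorAlgebra K V,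
      a * (ExteriorAlgebra.ι K (e i) * ExteriorAlgebra.ι K (e j)) =
      ExteriorAlgebra.ι K (e i) * ExteriorAlgebra.ι K (e j) * a :=
    fun a => (commute_ι_mul_ι _ _ a).eq.symm
  have h1 : ExteriorAlgebra.ι K (e i) * (ExteriorAlgebra.ι K (e i) * ExteriorAlgebra.ι K (e j))
      = 0 := by
    rw [← mul_assoc, ExteriorAlgebra.ι_sq_zero, zero_mul]
  have h2 : ExteriorAlgebra.ι K (e j) * (ExteriorAlgebra.ι K (e i) * ExteriorAlgebra.ι K (e j))
      = 0 := by
    rw [h, mul_assoc, ExteriorAlgebra.ι_sq_zero, mul_zero]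
  simp only [letterVal, two_mul, mul_add, add_mul, mul_one, one_mul, mul_assoc, h1, h2, mul_zero]
  rw [ι_mul_comm (e j) (e i)]
  abel

/-- The central factors collected on the way multiply to a single one, because `(e_i u)(e_i v) = 0`
makes their product additive in the second vector. -/
theorem letterVal_mul_wordVal (i : ι) (q : List ι) :
    letterVal K e i * wordVal K e q = wordVal K e q * letterVal K e i *
      (1 + 2 * (ExteriorAlgebra.ι K (e i) * ExteriorAlgebra.ι K (q.map e).sum)) := by
  induction q with
  | nil => simp
  | cons j q ih =>
    have hc := fun a => (commute_one_add_two_mul (K := K) (e i) (e j) a).eq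
    have hprod : (1 + 2 * (ExteriorAlgebra.ι K (e i) * ExteriorAlgebra.ι K (q.map e).sum)) *
        (1 + 2 * (ExteriorAlgebra.ι K (e i) * ExteriorAlgebra.ι K (e j))) =
        1 + 2 * (ExteriorAlgebra.ι K (e i) * ExteriorAlgebra.ι K ((j :: q).map e).sum) := by
      have := ι_mul_ι_mul_left (K := K) (e i) (q.map e).sum (e j)
      simp only [List.map_cons, List.sum_cons, map_add, two_mul, mul_add, add_mul, mul_one,
        one_mul, this]
      abel
    rw [← hprod, wordVal_cons, ← mul_assoc, letterVal_mul_letterVal, mul_assoc, hc, ← mul_assoc,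
      mul_assoc (letterVal K e j), ih]
    simp only [mul_assoc]

theorem wordVal_mul_wordVal (p q : List ι) :
    wordVal K e p * wordVal K e q = wordVal K e q * wordVal K e p *
      (1 + 2 * (ExteriorAlgebra.ι K (p.map e).sum * ExteriorAlgebra.ι K (q.map e).sum)) := by
  induction p with
  | nil => simp
  | cons i p ih =>
    have hc := fun a => (commute_one_add_two_mul (K := K) (e i) (q.map e).sum a).eq
    have hprod : (1 + 2 * (ExteriorAlgebra.ι K (e i) * ExteriorAlgebra.ι K (q.map e).sum)) *
        (1 + 2 * (ExteriorAlgebra.ι K (p.map e).sum * ExteriorAlgebra.ι K (q.map e).sum)) =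
        1 + 2 * (ExteriorAlgebra.ι K ((i :: p).map e).sum * ExteriorAlgebra.ι K (q.map e).sum) := by
      have := ι_mul_ι_mul_right (K := K) (e i) (p.map e).sum (q.map e).sum
      simp only [List.map_cons, List.sum_cons, map_add, two_mul, mul_add, add_mul, mul_one,
        one_mul, this]
      abel
    rw [wordVal_cons, mul_assoc, ih, ← mul_assoc, ← mul_assoc, letterVal_mul_wordVal, ← hprod,
      mul_assoc _ _ (wordVal K e p), hc]
    simp only [mul_assoc]

/-- With `P, Q, R` the vector sums of the three words, the inner commutator is the value of `q ++ p`
times the central element `2PQ`. Moving `r` past `q ++ p` produces the correction `2(Q + P)R`, which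
`PQ` annihilates. -/
theorem lie_lie_wordVal (p q r : List ι) :
    ⁅⁅wordVal K e p, wordVal K e q⁆, wordVal K e r⁆ = 0 := by
  set P := ExteriorAlgebra.ι K (p.map e).sum with hP
  set Q := ExteriorAlgebra.ι K (q.map e).sum with hQ
  set R := ExteriorAlgebra.ι K (r.map e).sum with hR
  have h1 : ⁅wordVal K e p, wordVal K e q⁆ = wordVal K e (q ++ p) * (2 * (P * Q)) := by
    rw [Ring.lie_def, wordVal_mul_wordVal, wordVal_append]
    noncomm_ring
  have hc : ∀ a, P * Q * a = a * (P * Q) := fun a => (commute_ι_mul_ι _ _ a).eq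
  have h2 : wordVal K e (q ++ p) * wordVal K e r = wordVal K e r * wordVal K e (q ++ p) +
      wordVal K e r * wordVal K e (q ++ p) * (2 * ((Q + P) * R)) := by
    rw [wordVal_mul_wordVal]
    simp only [List.map_append, List.sum_append, map_add, ← hP, ← hQ, ← hR]
    noncomm_ring
  have h3 : (Q + P) * R * (P * Q) = 0 := by
    have a : Q * R * (P * Q) = 0 := by
      rw [hP, hQ, hR, ι_mul_comm (List.map e p).sum, mul_neg, ι_mul_ι_mul_left, neg_zero]
    rw [add_mul, add_mul, a, hP, hQ, hR, ι_mul_ι_mul_left, add_zero]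
  have h4 : wordVal K e (q ++ p) * wordVal K e r * (P * Q) =
      wordVal K e r * wordVal K e (q ++ p) * (P * Q) := by
    rw [h2, add_mul, mul_assoc _ (2 * _) (P * Q), mul_assoc 2, h3]
    simp
  rw [h1, Ring.lie_def, two_mul]
  simp only [mul_add, add_mul]
  rw [mul_assoc, hc (wordVal K e r), ← mul_assoc, h4]
  noncomm_ring

theorem isUnit_letterVal (i : ι) : IsUnit (letterVal K e i) := by
  refine ⟨⟨letterVal K e i, 1 - ExteriorAlgebra.ι K (e i), ?_, ?_⟩, rfl⟩ <;>
    simp [letterVal, mul_sub, sub_mul, mul_add, add_mul]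

theorem isUnit_wordVal (l : List ι) : IsUnit (wordVal K e l) := by
  induction l with
  | nil => simp
  | cons i l ih =>
    rw [wordVal_cons]
    exact (isUnit_letterVal K e i).mul ih

variable [LinearOrder ι]

/-- The central factor of a pair of letters: `1 + 2 e_i e_j` if the pair is inverted. -/
def invVal (i j : ι) : ExteriorAlgebra K V :=
  if j < i then 1 + 2 * (ExteriorAlgebra.ι K (e i) * ExteriorAlgebra.ι K (e j)) else 1

theorem commute_invVal (i j : ι) (a : ExteriorAlgebra K V) : Commute (invVal K e i j) a := by
  unfold invVal
  split_ifs
  · exact commute_one_add_two_mul _ _ a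
  · exact Commute.one_left a

/-- The product of the central factors of all pairs of positions in a word. -/
def invProd : List ι → ExteriorAlgebra K V
  | [] => 1
  | i :: l => (l.map (invVal K e i)).prod * invProd l

theorem letterVal_mul_wordVal_sorted (i : ι) (l : List ι) (hl : l.Pairwise (· ≤ ·)) :
    letterVal K e i * wordVal K e l =
      wordVal K e (l.orderedInsert (· ≤ ·) i) * (l.map (invVal K e i)).prod := by
  induction l with
  | nil => simp
  | cons a l ih =>
    rw [List.pairwise_cons] at hl
    by_cases h : i ≤ a
    · have h1 : ((a :: l).map (invVal K e i)).prod = 1 := by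
        apply List.prod_eq_one
        intro z hz
        obtain ⟨j, hj, rfl⟩ := List.mem_map.1 hz
        have : i ≤ j := by
          rcases List.mem_cons.1 hj with rfl | hj
          · exact h
          · exact h.trans (hl.1 j hj)
        simp [invVal, not_lt.2 this]
      rw [h1, List.orderedInsert_cons_of_le _ _ h]
      simp
    · rw [List.orderedInsert_of_not_le _ _ h, wordVal_cons, wordVal_cons, List.map_cons,
        List.prod_cons, ← mul_assoc, letterVal_mul_letterVal]
      have : invVal K e i a = 1 + 2 * (ExteriorAlgebra.ι K (e i) * ExteriorAlgebra.ι K (e a)) := by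
        simp [invVal, not_le.1 h]
      rw [← this, (commute_invVal K e i a _).eq.symm, mul_assoc, mul_assoc, ih hl.2, mul_assoc,
        ← mul_assoc, (commute_invVal K e i a _).eq]
      simp only [mul_assoc]
      rw [(commute_invVal K e i a _).eq]
      simp only [mul_assoc]
      rw [(commute_invVal K e i a _).eq]

/-- Insertion sort, one letter at a time: each inverted pair contributes its factor once. Since the
factors are central, it does not matter that the tail has already been sorted. -/
theorem wordVal_eq (l : List ι) :
    wordVal K e l = wordVal K e (l.insertionSort (· ≤ ·)) * invProd K e l := by
  induction l with
  | nil => simp [invProd]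
  | cons i l ih =>
    have hp : ((l.insertionSort (· ≤ ·)).map (invVal K e i)).prod
        = (l.map (invVal K e i)).prod :=
      ((l.perm_insertionSort (· ≤ ·)).map _).prod_eq'
        (List.pairwise_of_forall_mem_list (by
          intro a ha b _
          obtain ⟨j, _, rfl⟩ := List.mem_map.1 ha
          exact commute_invVal K e i j b))
    rw [wordVal_cons, ih, ← mul_assoc,
      letterVal_mul_wordVal_sorted K e i _ (l.pairwise_insertionSort (· ≤ ·)), hp, mul_assoc]
    rfl

theorem map_invProd {W : Type*} [AddCommGroup W] [Module K W]
    (F : ExteriorAlgebra K V →ₐ[K] ExteriorAlgebra K W) (e' : ι → W) (l : List ι)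
    (h : l.Pairwise fun i j => F (invVal K e i j) = invVal K e' i j) :
    F (invProd K e l) = invProd K e' l := by
  induction l with
  | nil => simp [invProd]
  | cons i l ih =>
    rw [List.pairwise_cons] at h
    rw [invProd, invProd, map_mul, ih h.2, map_list_prod, List.map_map]
    congr 2
    exact List.map_congr_left h.1

theorem invProd_append_of_inv_eq_one (m l : List ι)
    (hm : m.Pairwise fun i j => invVal K e i j = 1)
    (hl : ∀ i ∈ m, ∀ j ∈ l, invVal K e i j = 1) :
    invProd K e (m ++ l) = invProd K e l := by
  induction m with
  | nil => rfl
  | cons i m ih =>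
    rw [List.pairwise_cons] at hm
    rw [List.cons_append, invProd, ih hm.2 fun i hi => hl i (List.mem_cons_of_mem _ hi)]
    have : ((m ++ l).map (invVal K e i)).prod = 1 := by
      apply List.prod_eq_one
      intro z hz
      obtain ⟨j, hj, rfl⟩ := List.mem_map.1 hz
      rcases List.mem_append.1 hj with hj | hj
      · exact hm.1 j hj
      · exact hl i (List.mem_cons_self ..) j hj
    rw [this, one_mul]

end Grassmann

/-! ### The multigraded evaluation and the linear relations it imposes on `T`. -/

section Evaluation

variable {K V ι : Type*} [Field K] [AddCommGroup V] [Module K V] (e : ι → V)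

/-- The value of a word in the exterior algebra, graded by the multiset of its letters. -/
noncomputable def gradedWordVal (K : Type*) [Field K] [Module K V] : FreeMonoid ι →*
    MonoidAlgebra (ExteriorAlgebra K V) (Multiplicative (Multiset ι)) where
  toFun w := MonoidAlgebra.single (Multiplicative.ofAdd (w.toList : Multiset ι))
    (wordVal K e w.toList)
  map_one' := rfl
  map_mul' v w := by
    rw [MonoidAlgebra.single_mul_single, ← ofAdd_add, FreeMonoid.toList_mul, wordVal_append]
    rfl

theorem gradedWordVal_apply (w : FreeMonoid ι) : gradedWordVal e K w =
    MonoidAlgebra.single (Multiplicative.ofAdd (w.toList : Multiset ι))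
      (wordVal K e w.toList) := rfl

/-- The linear extension of `gradedWordVal` to the free algebra. -/
noncomputable def gradedVal (K : Type*) [Field K] [Module K V] :
    FreeAlg K ι →ₐ[K] MonoidAlgebra (ExteriorAlgebra K V) (Multiplicative (Multiset ι)) :=
  MonoidAlgebra.lift K _ (FreeMonoid ι) (gradedWordVal e K)

theorem gradedVal_single (w : FreeMonoid ι) (r : K) :
    gradedVal e K (MonoidAlgebra.single w r) =
      r • MonoidAlgebra.single (Multiplicative.ofAdd (w.toList : Multiset ι))
        (wordVal K e w.toList) := by
  rw [gradedVal, MonoidAlgebra.lift_single, gradedWordVal_apply]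

/-- By trilinearity the three arguments may be words. Degrees commute, so a commutator of
homogeneous elements is again homogeneous and `lie_lie_wordVal` applies to the coefficients. -/
theorem lie_lie_gradedVal (p q r : FreeAlg K ι) :
    ⁅⁅gradedVal e K p, gradedVal e K q⁆, gradedVal e K r⁆ = 0 := by
  simp only [Ring.lie_def]
  induction p using MonoidAlgebra.induction_linear with
  | zero => simp
  | add p p' h h' =>
    -- Once `0` is split as `0 + 0`, the induction hypotheses read backwards turn each summand into
    -- a double commutator, and additivity remains.
    rw [← add_zero (0 : MonoidAlgebra _ _)]
    nth_rewrite 1 [← h]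
    rw [← h', map_add]
    noncomm_ring
  | single p a =>
    induction q using MonoidAlgebra.induction_linear with
    | zero => simp
    | add q q' h h' =>
      rw [← add_zero (0 : MonoidAlgebra _ _)]
      nth_rewrite 1 [← h]
      rw [← h', map_add]
      noncomm_ring
    | single q b =>
      induction r using MonoidAlgebra.induction_linear with
      | zero => simp
      | add r r' h h' =>
        rw [← add_zero (0 : MonoidAlgebra _ _)]
        nth_rewrite 1 [← h]
        rw [← h', map_add]
        noncomm_ring
      | single r c =>
        have h := lie_lie_wordVal K e p.toList q.toList r.toList
        have hm : ∀ (m n : Multiplicative (Multiset ι)) (a b : ExteriorAlgebra K V),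
            MonoidAlgebra.single m a * MonoidAlgebra.single n b -
              MonoidAlgebra.single n b * MonoidAlgebra.single m a =
              MonoidAlgebra.single (m * n) (a * b - b * a) := by
          intro m n a b
          rw [MonoidAlgebra.single_mul_single,
            MonoidAlgebra.single_mul_single, mul_comm n m, MonoidAlgebra.single_sub]
        rw [Ring.lie_def, Ring.lie_def] at h
        simp only [gradedVal_single, smul_mul_assoc, mul_smul_comm, ← smul_sub,
          smul_comm b a, smul_comm c a, smul_comm c b, hm, h, MonoidAlgebra.single_zero, smul_zero]

theorem tIdeal_le_ker :
    tIdeal ι {⁅⁅x K 0, x K 1⁆, x K 2⁆} ≤ TwoSidedIdeal.ker (gradedVal e K) := by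
  refine TwoSidedIdeal.span_le.2 ?_
  rintro _ ⟨φ, u, rfl, rfl⟩
  rw [SetLike.mem_coe, TwoSidedIdeal.mem_ker]
  simpa [Ring.lie_def] using lie_lie_gradedVal e (φ (x K 0)) (φ (x K 1)) (φ (x K 2))

-- The component in the degree of `w` of the vanishing evaluation of `f`; the grading isolates the
-- rearrangements of `w`.
open Classical in
theorem sum_smul_wordVal_eq_zero {f : FreeAlg K ι}
    (hf : f ∈ tIdeal ι {⁅⁅x K 0, x K 1⁆, x K 2⁆}) (w : List ι) :
    ∑ v ∈ f.coeff.support, (if v.toList.Perm w then f.coeff v • wordVal K e v.toList else 0) = 0 := by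
  have h := tIdeal_le_ker e hf
  rw [TwoSidedIdeal.mem_ker, gradedVal, MonoidAlgebra.lift_apply, Finsupp.sum] at h
  have h' := congrArg (fun b => b.coeff (Multiplicative.ofAdd (w : Multiset ι))) h
  simp only [MonoidAlgebra.coeff_sum, Finsupp.coe_finsetSum, Finset.sum_apply,
    MonoidAlgebra.coeff_zero, Finsupp.coe_zero, Pi.zero_apply] at h'
  refine Eq.trans (Finset.sum_congr rfl fun v _ => ?_) h'
  simp only [gradedWordVal_apply, MonoidAlgebra.coeff_smul, Finsupp.smul_apply,
    MonoidAlgebra.coeff_single, Finsupp.single_apply, EmbeddingLike.apply_eq_iff_eq,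
    Multiset.coe_eq_coe, smul_ite, smul_zero]

open Classical in
theorem sum_smul_invProd_eq_zero [LinearOrder ι] {f : FreeAlg K ι}
    (hf : f ∈ tIdeal ι {⁅⁅x K 0, x K 1⁆, x K 2⁆}) (w : List ι) :
    ∑ v ∈ f.coeff.support, (if v.toList.Perm w then f.coeff v • invProd K e v.toList else 0) = 0 := by
  have h := sum_smul_wordVal_eq_zero e hf w
  -- All rearrangements of `w` share the same sorted word, whose value is a common unit factor that
  -- cancels.
  apply (isUnit_wordVal K e (w.insertionSort (· ≤ ·))).mul_right_eq_zero.1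
  rw [Finset.mul_sum]
  refine (Finset.sum_congr rfl fun v _ => ?_).trans h
  split_ifs with hv
  · rw [wordVal_eq K e v.toList, mul_smul_comm]
    congr 3
    exact ((w.perm_insertionSort _).trans
      (hv.symm.trans (v.toList.perm_insertionSort _).symm)).eq_of_pairwise'
      (w.pairwise_insertionSort _) (v.toList.pairwise_insertionSort _)
  · exact mul_zero _

end Evaluation

/-! ### The top coefficient of an exterior algebra. -/

section TopForm

variable (K : Type*) [Field K] (n : ℕ)

/-- The linear functional reading off the coefficient of the top exterior power of `K ^ n`. -/
noncomputable def topCoeff : ExteriorAlgebra K (Fin n → K) →ₗ[K] K :=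
  ExteriorAlgebra.liftAlternating (Pi.single n (Pi.basisFun K (Fin n)).det)

/-- In degree `n` the induced map multiplies the determinant form by `det p`; the functional ignores
all other degrees. Applied to coordinate projections, it shows that an element not involving some
basis vector has no top coefficient. -/
theorem topCoeff_map_of_det_eq_zero (p : (Fin n → K) →ₗ[K] (Fin n → K)) (hp : LinearMap.det p = 0)
    (a : ExteriorAlgebra K (Fin n → K)) : topCoeff K n (ExteriorAlgebra.map p a) = 0 := by
  have : (topCoeff K n).comp (ExteriorAlgebra.map p).toLinearMap = 0 := by
    apply ExteriorAlgebra.lhom_ext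
    intro i
    ext v
    simp only [LinearMap.compAlternatingMap_apply,
      LinearMap.comp_apply,
      AlgHom.toLinearMap_apply, ExteriorAlgebra.map_apply_ιMulti, topCoeff,
      ExteriorAlgebra.liftAlternating_apply_ιMulti, LinearMap.zero_apply]
    by_cases h : i = n
    · subst h
      rw [Pi.single_eq_same, Module.Basis.det_comp, hp, zero_mul]
    · rw [Pi.single_eq_of_ne h]
      rfl
  exact LinearMap.congr_fun this a

theorem topCoeff_prod_single :
    topCoeff K n (List.ofFn fun k => ExteriorAlgebra.ι K (Pi.single k (1 : K))).prod = 1 := by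
  rw [← ExteriorAlgebra.ιMulti_apply, topCoeff, ExteriorAlgebra.liftAlternating_apply_ιMulti,
    Pi.single_eq_same]
  convert (Pi.basisFun K (Fin n)).det_self
  simp

/-- The projection of `K ^ n` along a coordinate axis. -/
noncomputable def killCoord (k : Fin n) : (Fin n → K) →ₗ[K] (Fin n → K) :=
  LinearMap.pi fun j => if j = k then 0 else LinearMap.proj j

theorem det_killCoord (k : Fin n) : LinearMap.det (killCoord K n k) = 0 := by
  by_contra h
  have hi := (LinearMap.equivOfDetNeZero _ h).injective
  have : killCoord K n k (Pi.single k 1) = killCoord K n k 0 := by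
    ext j
    by_cases hj : j = k
    · simp [killCoord, hj]
    · simp [killCoord, hj]
  have := congrFun (hi this) k
  simp at this

end TopForm

/-! ### Vectors attached to a chosen list of letters. -/

section Coordinates

variable (K : Type*) [Field K] {ι : Type*} [DecidableEq ι] (L : List ι)

/-- The letters of `L` are sent to the standard basis vectors, the other letters to zero. -/
def coordVec (i : ι) : Fin L.length → K := fun k => if L.get k = i then 1 else 0

theorem coordVec_of_notMem {i : ι} (h : i ∉ L) : coordVec K L i = 0 := by
  ext k
  have : L.get k ≠ i := fun hk => h (hk ▸ L.get_mem k)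
  simp only [coordVec, this, if_false, Pi.zero_apply]

theorem killCoord_coordVec_of_ne (k : Fin L.length) {i : ι} (h : L.get k ≠ i) :
    killCoord K L.length k (coordVec K L i) = coordVec K L i := by
  ext j
  by_cases hj : j = k
  · subst hj
    have : coordVec K L i j = 0 := if_neg h
    simp [killCoord, this]
  · simp [killCoord, hj]

theorem topCoeff_prod_coordVec (hL : L.Nodup) :
    topCoeff K L.length (L.map fun i => ExteriorAlgebra.ι K (coordVec K L i)).prod = 1 := by
  rw [← topCoeff_prod_single K L.length]
  congr 2
  rw [← List.ofFn_get (L.map _)]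
  apply List.ext_get
  · simp
  · intro m h1 h2
    simp only [List.ofFn_get, List.get_eq_getElem, List.getElem_map, List.getElem_ofFn]
    congr 1
    ext j
    simp only [coordVec, List.get_eq_getElem, Pi.single_apply]
    have hm : m < L.length := by simpa using h1
    have : (L[(j : ℕ)] = L[m]) ↔ j = ⟨m, hm⟩ := by
      rw [hL.getElem_inj_iff, Fin.ext_iff]
    simp only [this]

end Coordinates

/-! ### Normal words and their smaller rearrangements. -/

section NormalWords

variable {ι : Type*}

/-- The letters of a list of descents. -/
def descentLetters (P : List (ι × ι)) : List ι := P.flatMap fun p => [p.1, p.2]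

@[simp] theorem descentLetters_nil : descentLetters ([] : List (ι × ι)) = [] := rfl

@[simp] theorem descentLetters_cons (p : ι × ι) (P : List (ι × ι)) :
    descentLetters (p :: P) = p.1 :: p.2 :: descentLetters P := rfl

variable [LinearOrder ι]

/-- The words without a subword that is the leading word of a Gröbner basis element: increasing
words into which descents `T b` are inserted, where each `T` is the first letter of its kind and
`b` exceeds the top of the preceding descent. Here `t` is the top of the descent that precedes the
word and `P` is the list of the descents of the word. -/
inductive NormalWord : WithBot ι → List (ι × ι) → List ι → Prop
  | sorted {t : WithBot ι} {m : List ι} (hm : m.Pairwise (· ≤ ·)) (ht : ∀ i ∈ m, t ≤ i) :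
      NormalWord t [] m
  | descent {t : WithBot ι} {m : List ι} {T b : ι} {P : List (ι × ι)} {w : List ι}
      (hm : m.Pairwise (· ≤ ·)) (ht : ∀ i ∈ m, t ≤ i) (hT : ∀ i ∈ m, i < T)
      (htb : t < b) (hbT : b < T) (hw : NormalWord T P w) :
      NormalWord t ((T, b) :: P) (m ++ T :: b :: w)

theorem NormalWord.le_of_mem {t : WithBot ι} {P : List (ι × ι)} {w : List ι}
    (h : NormalWord t P w) : ∀ i ∈ w, t ≤ i := by
  induction h with
  | sorted hm ht => exact ht
  | @descent t m T b P w hm ht hT htb hbT hw ih =>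
    intro i hi
    have htT : t ≤ T := htb.le.trans (WithBot.coe_le_coe.2 hbT.le)
    simp only [List.mem_append, List.mem_cons] at hi
    rcases hi with hi | rfl | rfl | hi
    · exact ht i hi
    · exact htT
    · exact htb.le
    · exact htT.trans (ih i hi)

/-- Each descent satisfies `t < b < T` with `t` the preceding top, so successive descents climb
strictly; this separation also makes their letters distinct. -/
theorem NormalWord.lt_of_mem_letters {t : WithBot ι} {P : List (ι × ι)} {w : List ι}
    (h : NormalWord t P w) : ∀ i ∈ descentLetters P, t < i := by
  induction h with
  | sorted hm ht => simp
  | @descent t m T b P w hm ht hT htb hbT hw ih =>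
    intro i hi
    have htT : t < T := htb.trans (WithBot.coe_lt_coe.2 hbT)
    simp only [descentLetters_cons, List.mem_cons] at hi
    rcases hi with rfl | rfl | hi
    · exact htT
    · exact htb
    · exact htT.trans (ih i hi)

theorem NormalWord.nodup_letters {t : WithBot ι} {P : List (ι × ι)} {w : List ι}
    (h : NormalWord t P w) : (descentLetters P).Nodup := by
  induction h with
  | sorted hm ht => simp
  | @descent t m T b P w hm ht hT htb hbT hw ih =>
    have h1 : ∀ i ∈ descentLetters P, T < i := fun i hi =>
      WithBot.coe_lt_coe.1 (hw.lt_of_mem_letters i hi)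
    simp only [descentLetters_cons, List.nodup_cons, List.mem_cons, not_or]
    exact ⟨⟨hbT.ne', fun h => (h1 _ h).false⟩, fun h => ((h1 _ h).trans hbT).false, ih⟩

/-- A lexicographically smaller rearrangement of a word `m T b w`, with `m` increasing, either
begins with `m T b` or takes the letter `b` too early. -/
theorem lex_descent_cases {m : List ι} {T b : ι} {w v : List ι} (hm : m.Pairwise (· ≤ ·))
    (hT : ∀ i ∈ m, i < T) (hbT : b < T) (hw : ∀ i ∈ w, T ≤ i) (hv : v.Perm (m ++ T :: b :: w))
    (hlex : List.Lex (· < ·) v (m ++ T :: b :: w)) :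
    (∃ v', v = m ++ T :: b :: v' ∧ List.Lex (· < ·) v' w) ∨
      ∃ p q, v = p ++ b :: q ∧ p <+: m ∧ ∀ i ∈ q, b < i := by
  induction m generalizing v with
  | nil =>
    cases hlex with
    | nil => simp at hv
    | @rel a v' _ _ haT =>
      right
      have ha : a ∈ T :: b :: w := hv.subset (List.mem_cons_self ..)
      simp only [List.mem_cons] at ha
      obtain rfl : a = b := by
        rcases ha with rfl | rfl | ha
        · exact (haT.false).elim
        · rfl
        · exact (haT.not_ge (hw a ha)).elim
      refine ⟨[], v', rfl, List.nil_prefix, fun i hi => ?_⟩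
      have : v'.Perm (T :: w) := (hv.trans (List.Perm.swap ..)).cons_inv
      rcases List.mem_cons.1 (this.subset hi) with rfl | hi
      · exact hbT
      · exact hbT.trans_le (hw i hi)
    | @cons _ v' _ h =>
      have hv' := hv.cons_inv
      cases h with
      | nil => simp at hv'
      | @rel a v'' _ _ hab =>
        rcases List.mem_cons.1 (hv'.subset (List.mem_cons_self ..)) with rfl | ha
        · exact (hab.false).elim
        · exact ((hab.trans hbT).not_ge (hw a ha)).elim
      | @cons _ v'' _ h => exact Or.inl ⟨v'', rfl, h⟩
  | cons c m ih =>
    rw [List.pairwise_cons] at hm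
    have hcT := hT c (List.mem_cons_self ..)
    cases hlex with
    | nil => simp at hv
    | @rel a v' _ _ hac =>
      right
      have ha : a ∈ c :: m ++ T :: b :: w := hv.subset (List.mem_cons_self ..)
      simp only [List.cons_append, List.mem_append, List.mem_cons] at ha
      -- Every letter other than `b` is at least `c`, so only `b` can come in front.
      obtain rfl : a = b := by
        rcases ha with rfl | ha | rfl | rfl | ha
        · exact (hac.false).elim
        · exact (hac.not_ge (hm.1 a ha)).elim
        · exact (hac.not_gt hcT).elim
        · rfl
        · exact (hac.not_ge (hcT.le.trans (hw a ha))).elim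
      refine ⟨[], v', rfl, List.nil_prefix, fun i hi => ?_⟩
      have : v'.Perm (c :: m ++ T :: w) := by
        refine (hv.trans ?_).cons_inv
        have := (List.perm_middle (a := a) (l₁ := c :: m ++ [T]) (l₂ := w))
        simpa using this
      have := this.subset hi
      simp only [List.cons_append, List.mem_append, List.mem_cons] at this
      rcases this with rfl | hi | rfl | hi
      · exact hac
      · exact hac.trans_le (hm.1 i hi)
      · exact hbT
      · exact hbT.trans_le (hw i hi)
    | @cons _ v' _ h =>
      rcases ih hm.2 (fun i hi => hT i (List.mem_cons_of_mem _ hi)) hv.cons_inv h with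
        ⟨v'', rfl, h'⟩ | ⟨p, q, rfl, hp, hq⟩
      · exact Or.inl ⟨v'', rfl, h'⟩
      · exact Or.inr ⟨c :: p, q, rfl, (List.prefix_cons_inj c).2 hp, hq⟩

/-- An increasing word is minimal among its rearrangements. -/
theorem not_lex_of_sorted {m v : List ι} (hm : m.Pairwise (· ≤ ·)) (hv : v.Perm m) :
    ¬ List.Lex (· < ·) v m := by
  induction m generalizing v with
  | nil => rw [hv.eq_nil]; intro h; cases h
  | cons c m ih =>
    rw [List.pairwise_cons] at hm
    intro h
    cases h with
    | nil => simp at hv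
    | @rel a v' _ _ hac =>
      rcases List.mem_cons.1 (hv.subset (List.mem_cons_self ..)) with rfl | ha
      · exact hac.false
      · exact hac.not_ge (hm.1 a ha)
    | @cons _ v' _ h => exact ih hm.2 hv.cons_inv h

/-- In a lexicographically smaller rearrangement of a normal word, some descent letter is not
inverted with any other descent letter. -/
theorem NormalWord.exists_not_inverted {t : WithBot ι} {P : List (ι × ι)} {w v : List ι}
    (h : NormalWord t P w) (hv : v.Perm w) (hlex : List.Lex (· < ·) v w) :
    ∃ b ∈ descentLetters P, v.Pairwise fun i j => (i ∈ descentLetters P ∨ i ≤ t) →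
      (j ∈ descentLetters P ∨ j ≤ t) → (i = b ∨ j = b) → i ≤ j := by
  -- The alternatives `i ≤ t` strengthen the claim for the induction: once `m T b` is stripped off,
  -- the outer letters `T` and `b` are covered by `i ≤ T`.
  induction h generalizing v with
  | sorted hm ht => exact (not_lex_of_sorted hm hv hlex).elim
  | @descent t m T b P w hm ht hT htb hbT hw ih =>
    have hwT : ∀ i ∈ w, T ≤ i := fun i hi => WithBot.coe_le_coe.1 (hw.le_of_mem i hi)
    have hPT : ∀ i ∈ descentLetters P, T < i := fun i hi =>
      WithBot.coe_lt_coe.1 (hw.lt_of_mem_letters i hi)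
    have htT : t < T := htb.trans (WithBot.coe_lt_coe.2 hbT)
    rcases lex_descent_cases hm hT hbT hwT hv hlex with ⟨v, rfl, hlex'⟩ | ⟨p, q, rfl, hp, hq⟩
    · have hv' : v.Perm w := by
        have := (List.perm_append_left_iff m).1 hv
        exact this.cons_inv.cons_inv
      obtain ⟨s, hs, hvs⟩ := ih hv' hlex'
      have hsT := hPT s hs
      have hlow : ∀ i, i ≤ T → ∀ j, (i = s ∨ j = s) → i ≤ j := by
        rintro i hi j (rfl | rfl)
        · exact (hi.not_gt hsT).elim
        · exact hi.trans hsT.le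
      have himp : ∀ i, (i ∈ descentLetters ((T, b) :: P) ∨ (i : WithBot ι) ≤ t) →
          (i ∈ descentLetters P ∨ (i : WithBot ι) ≤ T) := by
        rintro i (hi | hi)
        · simp only [descentLetters_cons, List.mem_cons] at hi
          rcases hi with rfl | rfl | hi
          · exact Or.inr le_rfl
          · exact Or.inr (WithBot.coe_le_coe.2 hbT.le)
          · exact Or.inl hi
        · exact Or.inr (hi.trans htT.le)
      refine ⟨s, by simp [hs], ?_⟩
      rw [List.pairwise_append, List.pairwise_cons, List.pairwise_cons]
      refine ⟨hm.imp fun h _ _ _ => h, ⟨fun j _ _ _ => hlow T le_rfl j, fun j _ _ _ =>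
        hlow b hbT.le j, ?_⟩, fun i hi j _ _ _ => hlow i (hT i hi).le j⟩
      exact hvs.imp fun h hi hj => h (himp _ hi) (himp _ hj)
    -- Here `b` itself works: all letters after it are larger, and a letter of the prefix of `m`
    -- that is a descent letter or at most `t` is at most `b`.
    · refine ⟨b, by simp, ?_⟩
      have hpm : ∀ i ∈ p, i ∈ m := fun i hi => hp.subset hi
      rw [List.pairwise_append, List.pairwise_cons]
      refine ⟨(hm.sublist hp.sublist).imp fun h _ _ _ => h, ⟨fun j hj _ _ _ => (hq j hj).le, ?_⟩, ?_⟩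
      · refine List.pairwise_of_forall_mem_list fun i hi j hj _ _ hb => ?_
        rcases hb with rfl | rfl
        · exact ((hq _ hi).false).elim
        · exact ((hq _ hj).false).elim
      · intro i hi j hj hiP _ hb
        rcases List.mem_cons.1 hj with rfl | hjq
        · rcases hiP with hiP | hiP
          · simp only [descentLetters_cons, List.mem_cons] at hiP
            rcases hiP with rfl | rfl | hiP
            · exact ((hT _ (hpm _ hi)).false).elim
            · exact le_rfl
            · exact ((hT _ (hpm _ hi)).not_gt (hPT _ hiP)).elim
          · exact WithBot.coe_le_coe.1 (hiP.trans htb.le)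
        · rcases hb with rfl | rfl
          · exact (hq j hjq).le
          · exact ((hq _ hjq).false).elim

/-- Apart from the descents, the only inversions pair some `i ∈ m` with the following `b < i`. Such
an `i` lies above `t` and is no descent letter, so `e i = 0` and the factor is trivial. -/
theorem NormalWord.invProd_eq {K V : Type*} [Field K] [AddCommGroup V] [Module K V] {e : ι → V}
    {t : WithBot ι} {P : List (ι × ι)} {w : List ι} (h : NormalWord t P w)
    (he : ∀ i, e i ≠ 0 → i ∈ descentLetters P ∨ (i : WithBot ι) ≤ t) :
    invProd K e w = (P.map fun p =>
      1 + 2 * (ExteriorAlgebra.ι K (e p.1) * ExteriorAlgebra.ι K (e p.2))).prod := by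
  have hle : ∀ i j : ι, i ≤ j → invVal K e i j = 1 := fun i j hij => by
    simp [invVal, not_lt.2 hij]
  have hcons : ∀ (i : ι) (l : List ι), (∀ j ∈ l, i ≤ j) → invProd K e (i :: l) = invProd K e l := by
    intro i l hl
    exact invProd_append_of_inv_eq_one K e [i] l (List.pairwise_singleton ..)
      (by simpa using fun j hj => hle i j (hl j hj))
  induction h with
  | sorted hm ht =>
    have := invProd_append_of_inv_eq_one K e _ [] (hm.imp fun h => hle _ _ h) (by simp)
    simpa [invProd] using this
  | @descent t m T b P w hm ht hT htb hbT hw ih =>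
    have hwT : ∀ i ∈ w, T ≤ i := fun i hi => WithBot.coe_le_coe.1 (hw.le_of_mem i hi)
    have hPT : ∀ i ∈ descentLetters P, T < i := fun i hi =>
      WithBot.coe_lt_coe.1 (hw.lt_of_mem_letters i hi)
    rw [invProd_append_of_inv_eq_one K e m _ (hm.imp fun h => hle _ _ h), invProd,
      hcons b w fun j hj => hbT.le.trans (hwT j hj), ih, List.map_cons, List.map_cons,
      List.prod_cons, List.prod_cons]
    · have h1 : (w.map (invVal K e T)).prod = 1 := by
        apply List.prod_eq_one
        intro z hz
        obtain ⟨j, hj, rfl⟩ := List.mem_map.1 hz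
        exact hle T j (hwT j hj)
      rw [h1, mul_one, invVal, if_pos hbT]
    · intro i hi
      rcases he i hi with h | h
      · simp only [descentLetters_cons, List.mem_cons] at h
        rcases h with rfl | rfl | h
        · exact Or.inr le_rfl
        · exact Or.inr (WithBot.coe_le_coe.2 hbT.le)
        · exact Or.inl h
      · exact Or.inr (h.trans (htb.le.trans (WithBot.coe_le_coe.2 hbT.le)))
    · intro i hi j hj
      simp only [List.mem_cons] at hj
      rcases hj with rfl | rfl | hj
      · exact hle i _ (hT i hi).le
      · rcases le_or_gt i j with hij | hij
        · exact hle i j hij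
        · have : e i = 0 := by
            by_contra h0
            rcases he i h0 with h | h
            · simp only [descentLetters_cons, List.mem_cons] at h
              rcases h with rfl | rfl | h
              · exact (hT _ hi).false
              · exact hij.false
              · exact (hT _ hi).not_gt (hPT _ h)
            · exact (WithBot.coe_lt_coe.2 hij).not_ge (h.trans htb.le)
          simp [invVal, this]
      · exact hle i j ((hT i hi).le.trans (hwT j hj))

end NormalWords

/-! ### Top coefficients of inversion products; leading words of `T` are not normal. -/

section TopCoefficient

variable {K ι : Type*} [Field K] [LinearOrder ι]

/-- Choosing the term `1` in the factor of a pair loses the vector of its second letter, so what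
remains is fixed by a coordinate projection and has no top coefficient. The prefactor `A`
accumulates the factors already treated. -/
theorem topCoeff_mul_prod_one_add (L : List ι) (P : List (ι × ι)) (hP : (descentLetters P).Nodup)
    (hPL : ∀ i ∈ descentLetters P, i ∈ L) (A : ExteriorAlgebra K (Fin L.length → K))
    (hA : ∀ p ∈ P, ∀ k, L.get k = p.2 → ExteriorAlgebra.map (killCoord K L.length k) A = A) :
    topCoeff K L.length (A * (P.map fun p => 1 + 2 * (ExteriorAlgebra.ι K (coordVec K L p.1) *
        ExteriorAlgebra.ι K (coordVec K L p.2))).prod) =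
      topCoeff K L.length (A * (P.map fun p => 2 * (ExteriorAlgebra.ι K (coordVec K L p.1) *
        ExteriorAlgebra.ι K (coordVec K L p.2))).prod) := by
  induction P generalizing A with
  | nil => rfl
  | cons p P ih =>
    simp only [descentLetters_cons, List.nodup_cons, List.mem_cons, not_or] at hP
    obtain ⟨⟨hp12, hp1⟩, hp2, hP⟩ := hP
    have hmem : ∀ q ∈ P, q.1 ∈ descentLetters P ∧ q.2 ∈ descentLetters P := fun q hq =>
      ⟨List.mem_flatMap.2 ⟨q, hq, by simp⟩, List.mem_flatMap.2 ⟨q, hq, by simp⟩⟩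
    have hPL' : ∀ i ∈ descentLetters P, i ∈ L := fun i hi => hPL i (by simp [hi])
    rw [List.map_cons, List.map_cons, List.prod_cons, List.prod_cons, ← mul_assoc A, ← mul_assoc A,
      mul_add, mul_one, add_mul, map_add]
    rw [ih hP hPL' (A * _), add_eq_right]
    · obtain ⟨k, hk⟩ := List.get_of_mem (hPL p.2 (by simp))
      rw [← topCoeff_map_of_det_eq_zero K L.length _ (det_killCoord K L.length k)
        (A * (P.map fun p => 1 + 2 * (ExteriorAlgebra.ι K (coordVec K L p.1) *
          ExteriorAlgebra.ι K (coordVec K L p.2))).prod)]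
      congr 1
      rw [map_mul, hA p (List.mem_cons_self ..) k hk, map_list_prod, List.map_map]
      congr 2
      refine List.map_congr_left fun q hq => ?_
      have h1 : L.get k ≠ q.1 := fun h => hp2 (hk ▸ h ▸ (hmem q hq).1)
      have h2 : L.get k ≠ q.2 := fun h => hp2 (hk ▸ h ▸ (hmem q hq).2)
      simp [two_mul, ExteriorAlgebra.map_apply_ι, killCoord_coordVec_of_ne K L k h1,
        killCoord_coordVec_of_ne K L k h2]
    · intro q hq k hk
      have h1 : L.get k ≠ p.1 := fun h => hp1 (h ▸ hk ▸ (hmem q hq).2)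
      have h2 : L.get k ≠ p.2 := fun h => hp2 (h ▸ hk ▸ (hmem q hq).2)
      rw [map_mul, hA q (List.mem_cons_of_mem _ hq) k hk]
      simp [two_mul, ExteriorAlgebra.map_apply_ι, killCoord_coordVec_of_ne K L k h1,
        killCoord_coordVec_of_ne K L k h2]

theorem topCoeff_prod_one_add_ne_zero (h2 : (2 : K) ≠ 0) (P : List (ι × ι))
    (hP : (descentLetters P).Nodup) :
    topCoeff K (descentLetters P).length (P.map fun p => 1 + 2 *
      (ExteriorAlgebra.ι K (coordVec K (descentLetters P) p.1) *
        ExteriorAlgebra.ι K (coordVec K (descentLetters P) p.2))).prod ≠ 0 := by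
  have h := topCoeff_mul_prod_one_add (K := K) (descentLetters P) P hP (fun _ h => h) 1
    (fun _ _ _ _ => map_one _)
  rw [one_mul, one_mul] at h
  rw [h]
  have key : ∀ (E : ι → ExteriorAlgebra K (Fin (descentLetters P).length → K)) (Q : List (ι × ι)),
      (Q.map fun p => 2 * (E p.1 * E p.2)).prod =
        (2 : K) ^ Q.length • ((descentLetters Q).map E).prod := by
    intro E Q
    induction Q with
    | nil => simp
    | cons q Q ih =>
      rw [List.map_cons, List.prod_cons, ih, descentLetters_cons, List.map_cons, List.map_cons,
        List.prod_cons, List.prod_cons, List.length_cons, pow_succ', mul_smul, mul_smul_comm,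
        smul_comm, two_smul, two_mul, add_mul, mul_assoc, smul_add]
  rw [key (fun i => ExteriorAlgebra.ι K (coordVec K (descentLetters P) i)), map_smul,
    topCoeff_prod_coordVec K _ hP, smul_eq_mul, mul_one]
  exact pow_ne_zero _ h2

/-- No nontrivial factor contains the vector of `s`, so the product is fixed by the projection
killing that coordinate. -/
theorem topCoeff_invProd_eq_zero (L : List ι) {s : ι} (hs : s ∈ L) (v : List ι)
    (hv : v.Pairwise fun i j => i ∈ L → j ∈ L → (i = s ∨ j = s) → i ≤ j) :
    topCoeff K L.length (invProd K (coordVec K L) v) = 0 := by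
  obtain ⟨k, hk⟩ := List.get_of_mem hs
  rw [← map_invProd K (coordVec K L) (ExteriorAlgebra.map (killCoord K L.length k))
    (coordVec K L) v]
  · exact topCoeff_map_of_det_eq_zero K L.length _ (det_killCoord K L.length k) _
  · refine hv.imp fun {i j} h => ?_
    by_cases hij : j < i
    · by_cases hi : i ∈ L
      · by_cases hj : j ∈ L
        · have h' := fun h' => hij.not_ge (h hi hj h')
          have h1 : L.get k ≠ i := fun e => h' (Or.inl (e ▸ hk))
          have h2 : L.get k ≠ j := fun e => h' (Or.inr (e ▸ hk))
          simp [invVal, hij, two_mul, ExteriorAlgebra.map_apply_ι, killCoord_coordVec_of_ne K L k h1,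
            killCoord_coordVec_of_ne K L k h2]
        · simp [invVal, coordVec_of_notMem K L hj]
      · simp [invVal, coordVec_of_notMem K L hi]
    · simp [invVal, hij]

/-- The leading word of an element of the T-ideal is not normal. -/
theorem not_normalWord_of_isLeadingWord (h2 : (2 : K) ≠ 0) {f : FreeAlg K ι}
    (hf : f ∈ tIdeal ι {⁅⁅x K 0, x K 1⁆, x K 2⁆}) {w : FreeMonoid ι}
    (hw : IsLeadingWord DegLexLT f w) (P : List (ι × ι)) : ¬ NormalWord ⊥ P w.toList := by
  classical
  intro hn
  set L := descentLetters P with hL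
  have h := congrArg (topCoeff K L.length) (sum_smul_invProd_eq_zero (coordVec K L) hf w.toList)
  -- In the relation for the rearrangements of `w`, only `w` itself has a nonzero top coefficient.
  rw [map_sum, map_zero, Finset.sum_eq_single w, if_pos (List.Perm.refl _), map_smul,
    hn.invProd_eq] at h
  · exact (mul_ne_zero (Finsupp.mem_support_iff.1 hw.1)
      (topCoeff_prod_one_add_ne_zero h2 P hn.nodup_letters)) h
  · intro i hi
    by_contra h
    exact hi (coordVec_of_notMem K L fun h' => h (Or.inl h'))
  · intro v hv hvw
    split_ifs with hp
    · have hlt := hw.2 v hv hvw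
      obtain ⟨s, hs, hpw⟩ := hn.exists_not_inverted hp
        ((List.shortlex_iff_lex hp.length_eq).1 hlt)
      rw [map_smul, topCoeff_invProd_eq_zero L hs _ (hpw.imp fun h hi hj =>
        h (Or.inl hi) (Or.inl hj)), smul_zero]
    · exact map_zero _
  · intro h
    exact (h hw.1).elim

end TopCoefficient

/-! ### Deg-lex and the calculus of leading words. -/

section LeadingWords

variable {K ι : Type*} [Field K] [LinearOrder ι]

theorem degLexLT_iff {u v : FreeMonoid ι} : DegLexLT u v ↔
    u.toList.length < v.toList.length ∨
      u.toList.length = v.toList.length ∧ u.toList < v.toList := List.shortlex_def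

theorem DegLexLT.trans {u v w : FreeMonoid ι} (h : DegLexLT u v) (h' : DegLexLT v w) :
    DegLexLT u w := by
  rw [degLexLT_iff] at *
  rcases h with h | ⟨h, hl⟩ <;> rcases h' with h' | ⟨h', hl'⟩
  · exact Or.inl (h.trans h')
  · exact Or.inl (h' ▸ h)
  · exact Or.inl (h ▸ h')
  · exact Or.inr ⟨h.trans h', hl.trans hl'⟩

theorem DegLexLT.ne {u v : FreeMonoid ι} (h : DegLexLT u v) : u ≠ v := by
  rintro rfl
  rw [degLexLT_iff] at h
  rcases h with h | ⟨_, h⟩ <;> exact h.false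

theorem DegLexLT.asymm {u v : FreeMonoid ι} (h : DegLexLT u v) : ¬ DegLexLT v u :=
  fun h' => (h.trans h').ne rfl

theorem degLexLT_of_ne {u v : FreeMonoid ι} (h : u ≠ v) : DegLexLT u v ∨ DegLexLT v u := by
  simp only [degLexLT_iff]
  rcases lt_trichotomy u.toList.length v.toList.length with hl | hl | hl
  · exact Or.inl (Or.inl hl)
  · rcases lt_or_gt_of_ne (fun h' : u.toList = v.toList => h (FreeMonoid.toList.injective h'))
      with h | h
    · exact Or.inl (Or.inr ⟨hl, h⟩)
    · exact Or.inr (Or.inr ⟨hl.symm, h⟩)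
  · exact Or.inr (Or.inl hl)

theorem DegLexLT.mul_left {u v : FreeMonoid ι} (h : DegLexLT u v) (w : FreeMonoid ι) :
    DegLexLT (w * u) (w * v) := List.Shortlex.append_left h _

/-- Equal lengths rule out a proper prefix, for which appending could reverse the order. -/
theorem lex_append_right_of_length_eq {s t : List ι} (hl : s.length = t.length)
    (h : List.Lex (· < ·) s t) (r : List ι) : List.Lex (· < ·) (s ++ r) (t ++ r) := by
  induction h with
  | nil => simp at hl
  | rel h => exact List.Lex.rel h
  | cons h ih => exact List.Lex.cons (ih (by simpa using hl))

theorem DegLexLT.mul_right {u v : FreeMonoid ι} (h : DegLexLT u v) (w : FreeMonoid ι) :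
    DegLexLT (u * w) (v * w) := by
  rw [degLexLT_iff] at *
  simp only [FreeMonoid.toList_mul, List.length_append]
  rcases h with h | ⟨hl, h⟩
  · exact Or.inl (by omega)
  · exact Or.inr ⟨by omega, lex_append_right_of_length_eq hl h _⟩

theorem IsLeadingWord.unique {f : FreeAlg K ι} {u v : FreeMonoid ι}
    (hu : IsLeadingWord DegLexLT f u) (hv : IsLeadingWord DegLexLT f v) : u = v := by
  by_contra h
  exact (hu.2 v hv.1 (Ne.symm h)).asymm (hv.2 u hu.1 h)

theorem exists_isLeadingWord {f : FreeAlg K ι} (hf : f ≠ 0) :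
    ∃ w, IsLeadingWord DegLexLT f w := by
  have key : ∀ s : Finset (FreeMonoid ι), s.Nonempty →
      ∃ w ∈ s, ∀ v ∈ s, v ≠ w → DegLexLT v w := by
    intro s hs
    induction hs using Finset.Nonempty.cons_induction with
    | singleton a => exact ⟨a, by simp, by simp⟩
    | cons a s ha hs ih =>
      obtain ⟨w, hw, hmax⟩ := ih
      have hne : a ≠ w := fun h => ha (h ▸ hw)
      rcases degLexLT_of_ne hne with h | h
      · refine ⟨w, by simp [hw], fun v hv hvw => ?_⟩
        rcases Finset.mem_cons.1 hv with rfl | hv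
        · exact h
        · exact hmax v hv hvw
      · refine ⟨a, by simp, fun v hv hva => ?_⟩
        rcases Finset.mem_cons.1 hv with rfl | hv
        · exact (hva rfl).elim
        · by_cases hvw : v = w
          · exact hvw ▸ h
          · exact (hmax v hv hvw).trans h
  obtain ⟨w, hw, h⟩ := key f.coeff.support
    (Finsupp.support_nonempty_iff.2 fun h => hf (MonoidAlgebra.coeff_eq_zero.1 h))
  exact ⟨w, hw, h⟩

/-- Deg-lex is compatible with concatenation on both sides, so `u * v` arises from one pair of words
only and cannot cancel. -/
theorem IsLeadingWord.mul {f g : FreeAlg K ι} {u v : FreeMonoid ι}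
    (hf : IsLeadingWord DegLexLT f u) (hg : IsLeadingWord DegLexLT g v) :
    IsLeadingWord DegLexLT (f * g) (u * v) := by
  classical
  have hlt : ∀ a ∈ f.coeff.support, ∀ b ∈ g.coeff.support, ¬ (a = u ∧ b = v) →
      DegLexLT (a * b) (u * v) := by
    intro a ha b hb hab
    by_cases hau : a = u
    · subst hau
      exact (hg.2 b hb fun h => hab ⟨rfl, h⟩).mul_left a
    · have h1 := (hf.2 a ha hau).mul_right b
      by_cases hbv : b = v
      · exact hbv ▸ h1
      · exact h1.trans ((hg.2 b hb hbv).mul_left u)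
  refine ⟨?_, fun w hw hwuv => ?_⟩
  · have huniq : UniqueMul f.coeff.support g.coeff.support u v := by
      intro a b ha hb h
      by_contra hab
      exact (hlt a ha b hb hab).ne h
    rw [Finsupp.mem_support_iff, MonoidAlgebra.coeff_mul_mul_of_uniqueMul huniq]
    exact mul_ne_zero (Finsupp.mem_support_iff.1 hf.1) (Finsupp.mem_support_iff.1 hg.1)
  · obtain ⟨a, ha, b, hb, rfl⟩ := Finset.mem_mul.1 (MonoidAlgebra.support_coeff_mul_subset f g hw)
    exact hlt a ha b hb fun h => hwuv (by rw [h.1, h.2])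

theorem IsLeadingWord.neg {f : FreeAlg K ι} {u : FreeMonoid ι}
    (hf : IsLeadingWord DegLexLT f u) : IsLeadingWord DegLexLT (-f) u := by
  simpa [IsLeadingWord] using hf

theorem IsLeadingWord.add_of_lt {f g : FreeAlg K ι} {u v : FreeMonoid ι}
    (hf : IsLeadingWord DegLexLT f u) (hg : IsLeadingWord DegLexLT g v) (hvu : DegLexLT v u) :
    IsLeadingWord DegLexLT (f + g) u := by
  classical
  have hlt : ∀ w ∈ g.coeff.support, DegLexLT w u := fun w hw => by
    by_cases h : w = v
    · exact h ▸ hvu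
    · exact (hg.2 w hw h).trans hvu
  have hgu : g.coeff u = 0 := by
    by_contra h
    exact (hlt u (Finsupp.mem_support_iff.2 h)).ne rfl
  refine ⟨?_, fun w hw hwu => ?_⟩
  · rw [Finsupp.mem_support_iff, MonoidAlgebra.coeff_add, Finsupp.add_apply, hgu, add_zero]
    exact Finsupp.mem_support_iff.1 hf.1
  · rcases Finset.mem_union.1 (Finsupp.support_add hw) with h | h
    · exact hf.2 w h hwu
    · exact hlt w h

theorem IsLeadingWord.sub_of_lt {f g : FreeAlg K ι} {u v : FreeMonoid ι}
    (hf : IsLeadingWord DegLexLT f u) (hg : IsLeadingWord DegLexLT g v) (hvu : DegLexLT v u) :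
    IsLeadingWord DegLexLT (f - g) u := by
  rw [sub_eq_add_neg]
  exact hf.add_of_lt hg.neg hvu

variable (K) in
/-- The word `l` as an element of the free algebra. -/
noncomputable def wordMonomial (l : List ι) : FreeAlg K ι :=
  MonoidAlgebra.of K (FreeMonoid ι) (FreeMonoid.ofList l)

theorem isLeadingWord_wordMonomial (l : List ι) :
    IsLeadingWord DegLexLT (wordMonomial K l) (FreeMonoid.ofList l) := by
  classical
  simp [IsLeadingWord, wordMonomial]

theorem isLeadingWord_x (i : ι) : IsLeadingWord DegLexLT (x K i) (FreeMonoid.of i) :=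
  isLeadingWord_wordMonomial [i]

theorem degLexLT_cons_of_lt {a b : ι} {u v : List ι} (hl : u.length = v.length) (h : a < b) :
    DegLexLT (FreeMonoid.ofList (a :: u)) (FreeMonoid.ofList (b :: v)) :=
  List.Shortlex.of_lex (by simp [hl]) (List.Lex.rel h)

theorem degLexLT_cons_cons_of_lt {a b c : ι} {u v : List ι} (hl : u.length = v.length)
    (h : b < c) :
    DegLexLT (FreeMonoid.ofList (a :: b :: u)) (FreeMonoid.ofList (a :: c :: v)) :=
  List.Shortlex.of_lex (by simp [hl]) (List.Lex.cons (List.Lex.rel h))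

theorem isLeadingWord_lie {i j : ι} (h : j < i) :
    IsLeadingWord DegLexLT ⁅x K i, x K j⁆ (FreeMonoid.of i * FreeMonoid.of j) :=
  ((isLeadingWord_x i).mul (isLeadingWord_x j)).sub_of_lt
    ((isLeadingWord_x j).mul (isLeadingWord_x i)) (degLexLT_cons_of_lt rfl h)

variable (K) in
/-- The product `[x_a, x_b] m [x_c, x_d]` for a word `m`. -/
noncomputable def lieMulLie (a b : ι) (m : List ι) (c d : ι) : FreeAlg K ι :=
  ⁅x K a, x K b⁆ * wordMonomial K m * ⁅x K c, x K d⁆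

theorem isLeadingWord_lieMulLie {a b c d : ι} (m : List ι) (hab : b < a) (hcd : d < c) :
    IsLeadingWord DegLexLT (lieMulLie K a b m c d)
      (FreeMonoid.ofList (a :: b :: (m ++ [c, d]))) :=
  ((isLeadingWord_lie hab).mul (isLeadingWord_wordMonomial m)).mul (isLeadingWord_lie hcd)

end LeadingWords

/-! ### The basis elements indexed by their leading words. -/

section Generators

variable {ι : Type*} [LinearOrder ι]

/-- The words of length three that are leading words of Gröbner basis elements. -/
def LeadTriple (a b c : ι) : Prop := (c < b ∧ b ≤ a) ∨ (c < a ∧ b ≤ c)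

/-- The words `a b m c d` that are leading words of Gröbner basis elements. -/
def LeadPair (a b : ι) (m : List ι) (c d : ι) : Prop :=
  b < a ∧ d < c ∧ a ≤ c ∧ d ≤ a ∧ m.Pairwise (· ≤ ·) ∧ ∀ p ∈ m, a ≤ p ∧ p < c

variable (K : Type*) [Field K]

/-- The element of the Gröbner basis with leading word `a b c`. -/
noncomputable def tripleGen (a b c : ι) : FreeAlg K ι :=
  if c < b then ⁅x K a, ⁅x K b, x K c⁆⁆ else ⁅⁅x K a, x K b⁆, x K c⁆

/-- The element of the Gröbner basis with leading word `a b m c d`. -/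
noncomputable def pairGen (a b : ι) (m : List ι) (c d : ι) : FreeAlg K ι :=
  if d = b ∨ d = a ∨ c = a then lieMulLie K a b m c d
  else if d < b then lieMulLie K a b m c d + lieMulLie K a d m c b
  else lieMulLie K a b m c d + lieMulLie K d b m c a

/-- The elements of the Gröbner basis together with their leading words. -/
inductive IsBasisElement : List ι → FreeAlg K ι → Prop
  | triple {a b c : ι} (h : LeadTriple a b c) : IsBasisElement [a, b, c] (tripleGen K a b c)
  | pair {a b : ι} {m : List ι} {c d : ι} (h : LeadPair a b m c d) :
      IsBasisElement (a :: b :: (m ++ [c, d])) (pairGen K a b m c d)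

variable {K}

/-- In the two-term cases, the equalities excluded by the first branch of `pairGen` leave both
commutators of the added term with larger letter first, and its leading word is smaller at the first
or second letter. -/
theorem IsBasisElement.isLeadingWord {w : List ι} {p : FreeAlg K ι} (h : IsBasisElement K w p) :
    IsLeadingWord DegLexLT p (FreeMonoid.ofList w) := by
  cases h with
  | @triple a b c h =>
    unfold tripleGen
    split_ifs with hcb
    · have hba : b ≤ a := by
        rcases h with h | h
        · exact h.2
        · exact (hcb.not_ge h.2).elim
      refine ((isLeadingWord_x a).mul (isLeadingWord_lie hcb)).sub_of_lt
        ((isLeadingWord_lie hcb).mul (isLeadingWord_x a)) ?_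
      rcases hba.lt_or_eq with hba | rfl
      · exact degLexLT_cons_of_lt (u := [c, a]) (v := [b, c]) rfl hba
      · exact degLexLT_cons_cons_of_lt (u := [b]) (v := [c]) rfl hcb
    · have hca : c < a ∧ b ≤ c := by
        rcases h with h | h
        · exact (hcb h.1).elim
        · exact h
      have hba := hca.2.trans_lt hca.1
      exact ((isLeadingWord_lie hba).mul (isLeadingWord_x c)).sub_of_lt
        ((isLeadingWord_x c).mul (isLeadingWord_lie hba))
        (degLexLT_cons_of_lt (u := [a, b]) (v := [b, c]) rfl hca.1)
  | @pair a b m c d h =>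
    obtain ⟨hba, hdc, hac, hda, -, -⟩ := h
    have hlead := isLeadingWord_lieMulLie (K := K) m hba hdc
    unfold pairGen
    split_ifs with h1 h2
    · exact hlead
    · exact hlead.add_of_lt (isLeadingWord_lieMulLie m (h2.trans hba) (hba.trans_le hac))
        (degLexLT_cons_cons_of_lt (by simp) h2)
    · simp only [not_or] at h1
      have hbd : b < d := lt_of_le_of_ne (not_lt.1 h2) (Ne.symm h1.1)
      have hda := lt_of_le_of_ne hda h1.2.1
      have hac := lt_of_le_of_ne hac (Ne.symm h1.2.2)
      exact hlead.add_of_lt (isLeadingWord_lieMulLie m hbd hac)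
        (degLexLT_cons_of_lt (by simp) hda)

theorem le_of_infix_sorted {c d : ι} {l : List ι} (hl : l.Pairwise (· ≤ ·))
    (h : [c, d] <:+: l) : c ≤ d := by
  have := hl.sublist h.sublist
  simpa using this

/-- Hence the only descents of `a b m c d` are at its two ends, which drives the comparison of
leading words. -/
theorem LeadPair.sorted_tail {a b c d : ι} {m : List ι} (h : LeadPair a b m c d) :
    (b :: (m ++ [c])).Pairwise (· ≤ ·) := by
  obtain ⟨hba, hdc, hac, hda, hm, hmc⟩ := h
  rw [List.pairwise_cons, List.pairwise_append]
  refine ⟨fun i hi => ?_, hm, List.pairwise_singleton .., fun i hi j hj => ?_⟩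
  · rcases List.mem_append.1 hi with hi | hi
    · exact hba.le.trans (hmc i hi).1
    · rw [List.mem_singleton.1 hi]
      exact hba.le.trans hac
  · rw [List.mem_singleton.1 hj]
    exact (hmc i hi).2.le

/-- A leading word of length three does not occur in the other leading words. -/
theorem LeadPair.not_infix_triple {a b c d p q r : ι} {m : List ι} (h : LeadPair a b m c d)
    (h3 : LeadTriple p q r) : ¬ [p, q, r] <:+: a :: b :: (m ++ [c, d]) := by
  have hs := h.sorted_tail
  obtain ⟨hba, hdc, hac, hda, hm, hmc⟩ := h
  rintro ⟨s, t, hst⟩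
  have hrp : r < p := by
    rcases h3 with h3 | h3
    · exact h3.1.trans_le h3.2
    · exact h3.1
  have hlen : (a :: b :: (m ++ [c, d])) = a :: (b :: (m ++ [c]) ++ [d]) := by simp
  -- The triple satisfies `r < p`. At the left end and inside the increasing part this contradicts
  -- the order of the letters; at the right end `p < q` and `r < q` contradict both forms of
  -- `LeadTriple`.
  rcases s with _ | ⟨a', s⟩
  · simp only [List.nil_append, List.cons_append, List.cons.injEq] at hst
    obtain ⟨rfl, rfl, hst⟩ := hst
    have : p ≤ r := by
      cases m with
      | nil => simp only [List.nil_append, List.cons.injEq] at hst; exact hst.1 ▸ hac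
      | cons i m =>
        simp only [List.cons_append, List.cons.injEq] at hst
        exact hst.1 ▸ (hmc i (by simp)).1
    exact this.not_gt hrp
  · rw [hlen] at hst
    simp only [List.cons_append, List.cons.injEq] at hst
    obtain ⟨-, hst⟩ := hst
    rcases t.eq_nil_or_concat' with rfl | ⟨t, z, rfl⟩
    · have h1 : (s ++ [p]) ++ [q, r] = (b :: m) ++ [c, d] := by simpa using hst
      obtain ⟨h0, h2⟩ := List.append_inj' h1 rfl
      simp only [List.cons.injEq, and_true] at h2
      obtain ⟨rfl, rfl⟩ := h2
      have hp : p ∈ b :: m := h0 ▸ by simp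
      have hpq : p < q := by
        rcases List.mem_cons.1 hp with rfl | hp
        · exact hba.trans_le hac
        · exact (hmc p hp).2
      rcases h3 with h3 | h3
      · exact hpq.not_ge h3.2
      · exact hdc.not_ge h3.2
    · have h1 : (s ++ [p, q, r] ++ t) ++ [z] = (b :: (m ++ [c])) ++ [d] := by simpa using hst
      obtain ⟨h1, -⟩ := List.append_inj' h1 rfl
      have hsub : [p, r].Sublist (b :: (m ++ [c])) := by
        rw [← h1]
        refine (List.Sublist.trans ?_ (List.sublist_append_right s [p, q, r])).trans
          (List.sublist_append_left ..)
        simp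
      have := hs.sublist hsub
      simp only [List.pairwise_cons, List.mem_singleton, forall_eq] at this
      exact this.1.not_gt hrp

/-- A leading word with two descents does not properly contain another one. -/
theorem LeadPair.eq_of_infix {a b c d a' b' c' d' : ι} {m m' : List ι} (h : LeadPair a b m c d)
    (h' : LeadPair a' b' m' c' d')
    (hi : a :: b :: (m ++ [c, d]) <:+: a' :: b' :: (m' ++ [c', d'])) :
    a :: b :: (m ++ [c, d]) = a' :: b' :: (m' ++ [c', d']) := by
  have hs := h'.sorted_tail
  obtain ⟨hba, hdc, -⟩ := h
  obtain ⟨s, t, hst⟩ := hi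
  have hlen : (a' :: b' :: (m' ++ [c', d'])) = a' :: (b' :: (m' ++ [c']) ++ [d']) := by simp
  -- Any slack on the right puts the descent `c d`, and any slack on the left the descent `a b`,
  -- inside the increasing part of the longer word.
  rcases s with _ | ⟨e, s⟩
  · rcases t.eq_nil_or_concat' with rfl | ⟨t, z, rfl⟩
    · simpa using hst
    · exfalso
      rw [hlen] at hst
      have h1 : (b :: (m ++ [c, d]) ++ t) ++ [z] = (b' :: (m' ++ [c'])) ++ [d'] := by
        have := (List.cons.inj hst).2
        simpa using this
      obtain ⟨h1, -⟩ := List.append_inj' h1 rfl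
      exact (le_of_infix_sorted hs ⟨b :: m, t, by rw [← h1]; simp⟩).not_gt hdc
  · exfalso
    rw [hlen] at hst
    rcases (b :: (m ++ [c, d]) ++ t).eq_nil_or_concat' with h0 | ⟨t', z, h0⟩
    · simp at h0
    · have h1 : (s ++ a :: t') ++ [z] = (b' :: (m' ++ [c'])) ++ [d'] := by
        have h2 := (List.cons.inj hst).2
        rw [List.append_assoc s, List.cons_append, ← h0, ← h2]
        simp
      obtain ⟨h1, -⟩ := List.append_inj' h1 rfl
      rcases t' with _ | ⟨b1, t'⟩
      · have := congrArg List.length h0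
        simp at this
      · have hb : b = b1 := (List.cons.inj h0).1
        exact (le_of_infix_sorted hs ⟨s, t', by rw [← h1, hb]; simp⟩).not_gt hba

/-- The basis elements are determined by their leading words, none of which occurs in another. -/
theorem IsBasisElement.eq_of_infix {u w : List ι} {p q : FreeAlg K ι} (hp : IsBasisElement K u p)
    (hq : IsBasisElement K w q) (h : u <:+: w) : p = q := by
  cases hp with
  | triple h1 =>
    cases hq with
    | triple h2 =>
      have := h.eq_of_length rfl
      simp only [List.cons.injEq, and_true] at this
      obtain ⟨rfl, rfl, rfl⟩ := this
      rfl
    | pair h2 => exact (h2.not_infix_triple h1 h).elim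
  | pair h1 =>
    cases hq with
    | triple h2 =>
      have := h.length_le
      simp only [List.length_cons, List.length_append, List.length_nil] at this
      omega
    | pair h2 =>
      have := h1.eq_of_infix h2 h
      simp only [List.cons.injEq] at this
      obtain ⟨rfl, rfl, this⟩ := this
      obtain ⟨rfl, h4⟩ := List.append_inj' this rfl
      simp only [List.cons.injEq, and_true] at h4
      obtain ⟨rfl, rfl⟩ := h4
      rfl

end Generators

/-! ### Words avoiding all leading words are normal. -/

section Avoidance

variable {ι : Type*} [LinearOrder ι]

/-- No leading word of a basis element occurs in `w`. -/
def AvoidsLeads (w : List ι) : Prop :=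
  (∀ a b c, LeadTriple a b c → ¬ [a, b, c] <:+: w) ∧
    ∀ a b m c d, LeadPair a b m c d → ¬ a :: b :: (m ++ [c, d]) <:+: w

theorem AvoidsLeads.of_infix {u w : List ι} (hw : AvoidsLeads w) (h : u <:+: w) :
    AvoidsLeads u :=
  ⟨fun a b c h3 hi => hw.1 a b c h3 (hi.trans h),
    fun a b m c d h4 hi => hw.2 a b m c d h4 (hi.trans h)⟩

theorem sorted_or_exists_descent (w : List ι) : w.Pairwise (· ≤ ·) ∨
    ∃ m T b w', w = m ++ T :: b :: w' ∧ (m ++ [T]).Pairwise (· ≤ ·) ∧ b < T := by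
  induction w with
  | nil => exact Or.inl List.Pairwise.nil
  | cons i w ih =>
    rcases ih with hw | ⟨m, T, b, w', rfl, hm, hb⟩
    · rcases w with _ | ⟨j, w⟩
      · exact Or.inl (List.pairwise_singleton ..)
      · rcases le_or_gt i j with hij | hij
        · left
          refine List.pairwise_cons.2 ⟨fun k hk => ?_, hw⟩
          rcases List.mem_cons.1 hk with rfl | hk
          · exact hij
          · exact hij.trans ((List.pairwise_cons.1 hw).1 k hk)
        · exact Or.inr ⟨[], i, j, w, rfl, List.pairwise_singleton .., hij⟩
    · right
      rcases m with _ | ⟨j, m⟩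
      · rcases le_or_gt i T with hiT | hiT
        · exact ⟨[i], T, b, w', rfl, by simpa using hiT, hb⟩
        · exact ⟨[], i, T, b :: w', rfl, List.pairwise_singleton .., hiT⟩
      · rcases le_or_gt i j with hij | hij
        · refine ⟨i :: j :: m, T, b, w', rfl, List.pairwise_cons.2 ⟨fun k hk => ?_, hm⟩, hb⟩
          rcases List.mem_cons.1 hk with rfl | hk
          · exact hij
          · exact hij.trans ((List.pairwise_cons.1 hm).1 k hk)
        · exact ⟨[], i, j, m ++ T :: b :: w', rfl, List.pairwise_singleton .., hij⟩

theorem AvoidsLeads.lt_top {m : List ι} {T b : ι} {w : List ι}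
    (h : AvoidsLeads (m ++ T :: b :: w)) (hm : (m ++ [T]).Pairwise (· ≤ ·)) (hb : b < T) :
    ∀ i ∈ m, i < T := by
  rcases m.eq_nil_or_concat' with rfl | ⟨m, l, rfl⟩
  · simp
  · have hl : l < T := by
      by_contra hl
      exact h.1 l T b (Or.inl ⟨hb, not_lt.1 hl⟩) ⟨m, w, by simp⟩
    intro i hi
    rcases List.mem_append.1 hi with hi | hi
    · have := (List.pairwise_append.1 (List.pairwise_append.1 hm).1).2.2 i hi l (by simp)
      exact this.trans_lt hl
    · rw [List.mem_singleton.1 hi]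
      exact hl

/-- If `i < j`, then `j k i` is a forbidden triple, of the first form when `i < k` and of the second
when `k ≤ i`. -/
theorem AvoidsLeads.le_of_descent {j k i : ι} {w : List ι} (h : AvoidsLeads (j :: k :: i :: w))
    (hkj : k < j) : j ≤ i := by
  by_contra hij
  rw [not_le] at hij
  refine h.1 j k i ?_ ⟨[], w, by simp⟩
  rcases lt_or_ge i k with hik | hik
  · exact Or.inl ⟨hik, hkj.le⟩
  · exact Or.inr ⟨hij, hik⟩

theorem AvoidsLeads.exists_normalWord_of_descent (n : ℕ) : ∀ {j k : ι} {w : List ι},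
    w.length ≤ n → k < j → AvoidsLeads (j :: k :: w) → ∃ P, NormalWord (j : WithBot ι) P w := by
  induction n with
  | zero =>
    intro j k w hn _ _
    rw [List.length_eq_zero_iff.1 (Nat.le_zero.1 hn)]
    exact ⟨[], NormalWord.sorted List.Pairwise.nil (by simp)⟩
  | succ n ih =>
    intro j k w hn hkj hw
    have hge : ∀ {i : ι} {l r : List ι}, w = i :: l ++ r → (i :: l).Pairwise (· ≤ ·) →
        ∀ p ∈ i :: l, j ≤ p := by
      rintro i l r rfl hl p hp
      have hji := hw.le_of_descent hkj
      rcases List.mem_cons.1 hp with rfl | hp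
      · exact hji
      · exact hji.trans ((List.pairwise_cons.1 hl).1 p hp)
    have hge' : ∀ {l r : List ι}, w = l ++ r → l.Pairwise (· ≤ ·) → ∀ p ∈ l, j ≤ p := by
      intro l r hwl hl
      cases l with
      | nil => simp
      | cons i l => exact hge hwl hl
    rcases sorted_or_exists_descent w with hs | ⟨m, T, b, w', rfl, hm, hb⟩
    · exact ⟨[], NormalWord.sorted hs fun i hi => WithBot.coe_le_coe.2
        (hge' (List.append_nil w).symm hs i hi)⟩
    · have hinf : m ++ T :: b :: w' <:+: j :: k :: (m ++ T :: b :: w') :=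
        ⟨[j, k], [], by simp⟩
      have hmT := (hw.of_infix hinf).lt_top hm hb
      have hj := hge' (l := m ++ [T]) (r := b :: w') (by simp) hm
      obtain ⟨P, hP⟩ := ih (j := T) (k := b) (w := w')
        (by simp only [List.length_append, List.length_cons] at hn; omega) hb
        (hw.of_infix ⟨[j, k] ++ m, [], by simp⟩)
      refine ⟨_, NormalWord.descent (List.pairwise_append.1 hm).1
        (fun i hi => WithBot.coe_le_coe.2 (hj i (by simp [hi]))) hmT (WithBot.coe_lt_coe.2 ?_)
        hb hP⟩
      -- With `b ≤ j`, the stretch `j k m T b` between consecutive descents would be a forbidden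
      -- `LeadPair` word.
      by_contra hbj
      exact hw.2 j k m T b ⟨hkj, hb, hj T (by simp), not_lt.1 hbj, (List.pairwise_append.1 hm).1,
        fun p hp => ⟨hj p (by simp [hp]), hmT p hp⟩⟩ ⟨[], w', by simp⟩

theorem AvoidsLeads.exists_normalWord {w : List ι} (hw : AvoidsLeads w) :
    ∃ P, NormalWord ⊥ P w := by
  rcases sorted_or_exists_descent w with hs | ⟨m, T, b, w', rfl, hm, hb⟩
  · exact ⟨[], NormalWord.sorted hs fun _ _ => bot_le⟩
  · obtain ⟨P, hP⟩ := AvoidsLeads.exists_normalWord_of_descent w'.length le_rfl hb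
      (hw.of_infix ⟨m, [], by simp⟩)
    exact ⟨_, NormalWord.descent (List.pairwise_append.1 hm).1 (fun _ _ => bot_le)
      (hw.lt_top hm hb) (WithBot.bot_lt_coe b) hb hP⟩

end Avoidance

/-! ### Consequences of the identity: the basis lies in `T`. -/

section Membership

/-- In a ring where `[[a, b], c] = 0`, one has `[a, c] [b, d] + [a, d] [b, c] = 0`. -/
theorem lie_mul_lie_add_lie_mul_lie {R : Type*} [Ring R] (H : ∀ a b c : R, ⁅⁅a, b⁆, c⁆ = 0)
    (a b c d : R) : ⁅a, c⁆ * ⁅b, d⁆ + ⁅a, d⁆ * ⁅b, c⁆ = 0 := by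
  have h1 := H b c d
  have h2 := H a c d
  have h3 := H (a * b) c d
  -- Apply the Leibniz rule twice; the double commutators vanish and the two mixed terms remain.
  have h4 : ⁅⁅a * b, c⁆, d⁆ = ⁅a, d⁆ * ⁅b, c⁆ + a * ⁅⁅b, c⁆, d⁆ + ⁅⁅a, c⁆, d⁆ * b +
      ⁅a, c⁆ * ⁅b, d⁆ := by
    simp only [Ring.lie_def]
    noncomm_ring
  rw [h3, h1, h2, mul_zero, zero_mul, add_zero, add_zero] at h4
  rw [add_comm]
  exact h4.symm

theorem lie_mul_mul_lie {R : Type*} [Ring R] (H : ∀ a b c : R, ⁅⁅a, b⁆, c⁆ = 0)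
    (a b m c d : R) : ⁅a, b⁆ * m * ⁅c, d⁆ = m * (⁅a, b⁆ * ⁅c, d⁆) := by
  have h := H a b m
  rw [Ring.lie_def ⁅a, b⁆, sub_eq_zero] at h
  rw [h, mul_assoc]

variable {K ι : Type*} [Field K]

theorem lie_lie_mem_tIdeal (p q r : FreeAlg K ι) :
    ⁅⁅p, q⁆, r⁆ ∈ tIdeal ι {⁅⁅x K 0, x K 1⁆, x K 2⁆} := by
  -- Variables beyond the third do not occur in the identity, so their value `r` is immaterial.
  set s : ℕ → FreeAlg K ι := fun n => if n = 0 then p else if n = 1 then q else r with hs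
  set φ : FreeAlg K ℕ →ₐ[K] FreeAlg K ι :=
    MonoidAlgebra.lift K _ (FreeMonoid ℕ) (FreeMonoid.lift s) with hφ
  have h : ∀ n, φ (x K n) = s n := fun n => by
    rw [hφ, x, MonoidAlgebra.lift_of, FreeMonoid.lift_eval_of]
  refine TwoSidedIdeal.subset_span ⟨φ, _, rfl, ?_⟩
  simp only [Ring.lie_def, map_sub, map_mul, h]
  simp [hs]

theorem mem_of_add_self_mem (h2 : (2 : K) ≠ 0) {I : TwoSidedIdeal (FreeAlg K ι)} {f : FreeAlg K ι}
    (hf : f + f ∈ I) : f ∈ I := by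
  have h := I.mul_mem_left (algebraMap K _ (2⁻¹ : K)) _ hf
  rwa [← Algebra.smul_def, ← two_smul K f, smul_smul, inv_mul_cancel₀ h2, one_smul] at h

/-- In the quotient by `T` commutators are central, so `m` factors out and `[a,b][c,d]` changes sign
under the swaps of `b, d`, of `a, d` and of `a, c`. -/
theorem lieMulLie_add_lieMulLie_mem [LinearOrder ι] (a b : ι) (m : List ι) (c d : ι) :
    lieMulLie K a b m c d + lieMulLie K a d m c b ∈ tIdeal ι {⁅⁅x K 0, x K 1⁆, x K 2⁆} ∧
    lieMulLie K a b m c d + lieMulLie K d b m c a ∈ tIdeal ι {⁅⁅x K 0, x K 1⁆, x K 2⁆} ∧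
    lieMulLie K a b m c d + lieMulLie K c b m a d ∈ tIdeal ι {⁅⁅x K 0, x K 1⁆, x K 2⁆} := by
  set I : TwoSidedIdeal (FreeAlg K ι) := tIdeal ι {⁅⁅x K 0, x K 1⁆, x K 2⁆} with hI
  have hmem : ∀ f, f ∈ I ↔ I.ringCon.mk' f = 0 := fun f => by
    rw [← TwoSidedIdeal.mem_ker, TwoSidedIdeal.ker_ringCon_mk']
  have hlie : ∀ p q, I.ringCon.mk' ⁅p, q⁆ = ⁅I.ringCon.mk' p, I.ringCon.mk' q⁆ := fun p q => by
    simp only [Ring.lie_def, map_sub, map_mul]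
  have H : ∀ p q r : I.ringCon.Quotient, ⁅⁅p, q⁆, r⁆ = 0 := by
    intro p q r
    obtain ⟨p, rfl⟩ := RingCon.mk'_surjective _ p
    obtain ⟨q, rfl⟩ := RingCon.mk'_surjective _ q
    obtain ⟨r, rfl⟩ := RingCon.mk'_surjective _ r
    rw [← hlie, ← hlie, ← hmem]
    exact lie_lie_mem_tIdeal p q r
  have key := lie_mul_lie_add_lie_mul_lie H
  have hskew : ∀ p q : I.ringCon.Quotient, ⁅p, q⁆ = -⁅q, p⁆ := fun p q => by
    simp only [Ring.lie_def, neg_sub]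
  have hcomm : ∀ p q r s : I.ringCon.Quotient, ⁅p, q⁆ * ⁅r, s⁆ = ⁅r, s⁆ * ⁅p, q⁆ :=
    fun p q r s => sub_eq_zero.1 (H p q ⁅r, s⁆)
  simp only [hmem, map_add, lieMulLie, map_mul, hlie, lie_mul_mul_lie H, ← mul_add]
  set A := I.ringCon.mk' (x K a)
  set B := I.ringCon.mk' (x K b)
  set C := I.ringCon.mk' (x K c)
  set D := I.ringCon.mk' (x K d)
  refine ⟨?_, ?_, ?_⟩
  · rw [key, mul_zero]
  · rw [hskew A B, hskew D B, neg_mul, neg_mul, ← neg_add, key, neg_zero, mul_zero]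
  · rw [hcomm C B, key, mul_zero]

theorem IsBasisElement.mem_tIdeal [LinearOrder ι] (h2 : (2 : K) ≠ 0) {w : List ι}
    {p : FreeAlg K ι} (h : IsBasisElement K w p) :
    p ∈ tIdeal ι {⁅⁅x K 0, x K 1⁆, x K 2⁆} := by
  cases h with
  | @triple a b c h =>
    unfold tripleGen
    split_ifs
    · have := TwoSidedIdeal.neg_mem _ (lie_lie_mem_tIdeal (x K b) (x K c) (x K a))
      rwa [Ring.lie_def ⁅x K b, x K c⁆, neg_sub] at this
    · exact lie_lie_mem_tIdeal _ _ _
  | @pair a b m c d h =>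
    obtain ⟨h1, h3, h4⟩ := lieMulLie_add_lieMulLie_mem (K := K) a b m c d
    unfold pairGen
    split_ifs with hd hdb
    -- When `d = b`, `d = a` or `c = a`, the two terms of one exchange relation coincide, so twice
    -- the element lies in `T`.
    · refine mem_of_add_self_mem h2 ?_
      rcases hd with rfl | rfl | rfl
      · exact h1
      · exact h3
      · exact h4
    · exact h1
    · exact h3

end Membership

/-! ### Matching the listed families with the indexed basis elements. -/

section BasisSet

variable {K ι : Type*} [Field K]

theorem wordMonomial_append (l l' : List ι) :
    wordMonomial K (l ++ l') = wordMonomial K l * wordMonomial K l' := by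
  rw [wordMonomial, FreeMonoid.ofList_append, map_mul]
  rfl

theorem wordMonomial_replicate (n : ℕ) (i : ι) :
    wordMonomial K (List.replicate n i) = x K i ^ n := by
  induction n with
  | zero => exact map_one _
  | succ n ih => rw [List.replicate_succ', wordMonomial_append, ih, pow_succ]; rfl

theorem lieMulLie_nil (a b c d : ι) :
    lieMulLie K a b [] c d = ⁅x K a, x K b⁆ * ⁅x K c, x K d⁆ := by
  have : wordMonomial K ([] : List ι) = 1 := map_one _
  rw [lieMulLie, this, mul_one]

variable [LinearOrder ι]

theorem sorted_flatMap_replicate {l : List ι} (hl : l.Pairwise (· ≤ ·)) (a : ι → ℕ) :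
    (l.flatMap fun p => List.replicate (a p) p).Pairwise (· ≤ ·) := by
  induction l with
  | nil => simp
  | cons p l ih =>
    rw [List.pairwise_cons] at hl
    rw [List.flatMap_cons, List.pairwise_append]
    refine ⟨List.pairwise_replicate.2 (Or.inr le_rfl), ih hl.2, fun q hq r hr => ?_⟩
    obtain ⟨s, hs, hr⟩ := List.mem_flatMap.1 hr
    rw [List.eq_of_mem_replicate hq, List.eq_of_mem_replicate hr]
    exact hl.1 s hs

variable [LocallyFiniteOrder ι]

/-- The word `x_j ^ a_j ⋯ x_{i-1} ^ a_{i-1}`. -/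
def midWord (i j : ι) (a : ι → ℕ) : List ι :=
  ((Finset.Ico j i).sort (· ≤ ·)).flatMap fun p => List.replicate (a p) p

theorem mid_eq_wordMonomial (i j : ι) (a : ι → ℕ) :
    mid K i j a = wordMonomial K (midWord i j a) := by
  unfold mid midWord
  induction (Finset.Ico j i).sort (· ≤ ·) with
  | nil => exact (map_one _).symm
  | cons p l ih =>
    rw [List.map_cons, List.prod_cons, ih, List.flatMap_cons, wordMonomial_append,
      wordMonomial_replicate]

theorem mem_midWord {i j p : ι} {a : ι → ℕ} (h : p ∈ midWord i j a) : j ≤ p ∧ p < i := by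
  obtain ⟨q, hq, hp⟩ := List.mem_flatMap.1 h
  rw [List.eq_of_mem_replicate hp]
  exact Finset.mem_Ico.1 ((Finset.mem_sort _).1 hq)

theorem sorted_midWord (i j : ι) (a : ι → ℕ) : (midWord i j a).Pairwise (· ≤ ·) :=
  sorted_flatMap_replicate (Finset.pairwise_sort _ _) a

/-- An increasing word is determined by its letter multiplicities, which supply the exponents. -/
theorem midWord_count {i j : ι} {m : List ι} (hm : m.Pairwise (· ≤ ·))
    (hij : ∀ p ∈ m, j ≤ p ∧ p < i) : midWord i j (fun p => m.count p) = m := by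
  have key : ∀ (l : List ι) (q : ι), l.Nodup →
      (l.flatMap fun p => List.replicate (m.count p) p).count q =
        if q ∈ l then m.count q else 0 := by
    intro l q hl
    induction l with
    | nil => simp
    | cons p l ih =>
      rw [List.nodup_cons] at hl
      rw [List.flatMap_cons, List.count_append, ih hl.2, List.count_replicate]
      by_cases hpq : p = q
      · subst hpq
        simp [hl.1]
      · simp [hpq, Ne.symm hpq]
  refine List.Perm.eq_of_pairwise' (sorted_midWord i j _) hm (List.perm_iff_count.2 fun q => ?_)
  rw [midWord, key _ _ (Finset.sort_nodup _ _)]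
  split_ifs with h
  · rfl
  · rw [Finset.mem_sort, Finset.mem_Ico] at h
    exact (List.count_eq_zero.2 fun hq => h (hij q hq)).symm

theorem LeadPair.of_midWord {a b c d : ι} (hba : b < a) (hdc : d < c) (hac : a ≤ c) (hda : d ≤ a)
    (e : ι → ℕ) : LeadPair a b (midWord c a e) c d :=
  ⟨hba, hdc, hac, hda, sorted_midWord c a e, fun _ hp => mem_midWord hp⟩

theorem lieMulLie_midWord (a b c d : ι) (e : ι → ℕ) :
    lieMulLie K a b (midWord c a e) c d = ⁅x K a, x K b⁆ * mid K c a e * ⁅x K c, x K d⁆ := by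
  rw [mid_eq_wordMonomial, lieMulLie]

-- For `LeadPair` words, `c = a` forces `m = []` and gives `t`, `u₁`, `u₂`. If `a < c`, the cases `d
-- = a`, `d < b`, `d = b` and `b < d < a` give `v₂`, `w₁`, `v₁` and `w₂`.
variable (K ι) in
theorem basisSet_eq :
    (({p | ∃ i j : ι, i > j ∧ (p = f₁ K i j ∨ p = f₂ K i j ∨ p = t K i j)} ∪
        {p | ∃ i j k : ι, i > j ∧ j > k ∧
          (p = g₁ K i j k ∨ p = g₂ K i k j ∨ p = u₁ K i j k ∨ p = u₂ K i j k)} ∪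
        {p | ∃ i j k : ι, ∃ a : ι → ℕ, i > j ∧ j > k ∧ (p = v₁ K i j k a ∨ p = v₂ K i j k a)} ∪
        {p | ∃ i j k l : ι, ∃ a : ι → ℕ, i > j ∧ j > k ∧ k > l ∧
          (p = w₁ K i j k l a ∨ p = w₂ K i j k l a)}) : Set (FreeAlg K ι)) =
      {p | ∃ w, IsBasisElement K w p} := by
  ext p
  simp only [Set.mem_union, Set.mem_ofPred_eq]
  constructor
  · have triple : ∀ {a b c : ι}, LeadTriple a b c → p = tripleGen K a b c →
        ∃ w, IsBasisElement K w p := fun h hp => ⟨_, hp ▸ IsBasisElement.triple h⟩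
    have pair : ∀ {a b : ι} {m : List ι} {c d : ι}, LeadPair a b m c d →
        p = pairGen K a b m c d → ∃ w, IsBasisElement K w p :=
      fun h hp => ⟨_, hp ▸ IsBasisElement.pair h⟩
    have pairNil : ∀ {a b d : ι}, b < a → d < a → p = ⁅x K a, x K b⁆ * ⁅x K a, x K d⁆ →
        ∃ w, IsBasisElement K w p := by
      intro a b d hb hd hp
      refine pair (m := []) ⟨hb, hd, le_rfl, hd.le, List.Pairwise.nil, by simp⟩ ?_
      rw [hp, pairGen, if_pos (Or.inr (Or.inr rfl)), lieMulLie_nil]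
    rintro (((⟨i, j, hij, h⟩ | ⟨i, j, k, hij, hjk, h⟩) | ⟨i, j, k, a, hij, hjk, h⟩) |
      ⟨i, j, k, l, a, hij, hjk, hkl, h⟩)
    · rcases h with h | h | h
      · exact triple (Or.inr ⟨hij, le_rfl⟩) (h.trans (if_neg (lt_irrefl j)).symm)
      · exact triple (Or.inl ⟨hij, le_rfl⟩) (h.trans (if_pos hij).symm)
      · exact pairNil hij hij h
    · have hik : k < i := hjk.trans hij
      rcases h with h | h | h | h
      · exact triple (Or.inl ⟨hjk, hij.le⟩) (h.trans (if_pos hjk).symm)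
      · exact triple (Or.inr ⟨hij, hjk.le⟩) (h.trans (if_neg hjk.not_gt).symm)
      · exact pairNil hij hik h
      · exact pairNil hik hij h
    · have hik : k < i := hjk.trans hij
      rcases h with h | h
      · refine pair (LeadPair.of_midWord hjk hik hij.le hjk.le a) ?_
        rw [h, pairGen, if_pos (Or.inl rfl), lieMulLie_midWord, v₁]
      · refine pair (LeadPair.of_midWord hjk hij hij.le le_rfl a) ?_
        rw [h, pairGen, if_pos (Or.inr (Or.inl rfl)), lieMulLie_midWord, v₂]
    · have hik : k < i := hjk.trans hij
      have hjl : l < j := hkl.trans hjk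
      rcases h with h | h
      · refine pair (LeadPair.of_midWord hjk (hjl.trans hij) hij.le hjl.le a) ?_
        rw [h, pairGen, if_neg (by simp [hkl.ne, hjl.ne, hij.ne']), if_pos hkl,
          lieMulLie, lieMulLie, ← mid_eq_wordMonomial, w₁]
      · refine pair (LeadPair.of_midWord hjl hik hij.le hjk.le a) ?_
        rw [h, pairGen, if_neg (by simp [hkl.ne', hjk.ne, hij.ne']), if_neg hkl.not_gt,
          lieMulLie, lieMulLie, ← mid_eq_wordMonomial, w₂]
  · rintro ⟨w, h⟩
    cases h with
    | @triple a b c h =>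
      left; left
      rcases h with ⟨hcb, hba⟩ | ⟨hca, hbc⟩
      · rw [tripleGen, if_pos hcb]
        rcases hba.eq_or_lt with rfl | hba
        · exact Or.inl ⟨b, c, hcb, Or.inr (Or.inl rfl)⟩
        · exact Or.inr ⟨a, b, c, hba, hcb, Or.inl rfl⟩
      · rw [tripleGen, if_neg hbc.not_gt]
        rcases hbc.eq_or_lt with rfl | hbc
        · exact Or.inl ⟨a, b, hca, Or.inl rfl⟩
        · exact Or.inr ⟨a, c, b, hca, hbc, Or.inr (Or.inl rfl)⟩
    | @pair a b m c d h =>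
      obtain ⟨hba, hdc, hac, hda, hm, hmc⟩ := h
      rcases hac.eq_or_lt with rfl | hac
      · left; left
        have : m = [] := List.eq_nil_iff_forall_not_mem.2 fun p hp =>
          (hmc p hp).1.not_gt (hmc p hp).2
        rw [pairGen, if_pos (Or.inr (Or.inr rfl)), this, lieMulLie_nil]
        rcases lt_trichotomy d b with hdb | rfl | hdb
        · exact Or.inr ⟨a, b, d, hba, hdb, Or.inr (Or.inr (Or.inl rfl))⟩
        · exact Or.inl ⟨a, d, hba, Or.inr (Or.inr rfl)⟩
        · exact Or.inr ⟨a, d, b, hdc, hdb, Or.inr (Or.inr (Or.inr rfl))⟩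
      · rw [← midWord_count hm hmc]
        set e : ι → ℕ := fun p => m.count p
        rcases hda.eq_or_lt with rfl | hda
        · refine Or.inl (Or.inr ⟨c, d, b, e, hac, hba, Or.inr ?_⟩)
          rw [pairGen, if_pos (Or.inr (Or.inl rfl)), lieMulLie_midWord, v₂]
        · rcases lt_trichotomy d b with hdb | rfl | hdb
          · refine Or.inr ⟨c, a, b, d, e, hac, hba, hdb, Or.inl ?_⟩
            rw [pairGen, if_neg (by simp [hdb.ne, hda.ne, hac.ne']), if_pos hdb,
              lieMulLie, lieMulLie, ← mid_eq_wordMonomial, w₁]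
          · refine Or.inl (Or.inr ⟨c, a, d, e, hac, hba, Or.inl ?_⟩)
            rw [pairGen, if_pos (Or.inl rfl), lieMulLie_midWord, v₁]
          · refine Or.inr ⟨c, a, d, b, e, hac, hda, hdb, Or.inr ?_⟩
            rw [pairGen, if_neg (by simp [hdb.ne', hda.ne, hac.ne']), if_neg hdb.not_gt,
              lieMulLie, lieMulLie, ← mid_eq_wordMonomial, w₂]

end BasisSet

/-! ### The Gröbner property and minimality. -/

theorem isSubword_ofList_iff {ι : Type*} {u w : FreeMonoid ι} :
    IsSubword u w ↔ u.toList <:+: w.toList := by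
  constructor
  · rintro ⟨a, b, rfl⟩
    exact ⟨a.toList, b.toList, rfl⟩
  · rintro ⟨a, b, h⟩
    exact ⟨FreeMonoid.ofList a, FreeMonoid.ofList b, h.symm⟩

theorem isMinimalGroebnerBasis_basisElements {K ι : Type*} [Field K] [LinearOrder ι]
    (h2 : (2 : K) ≠ 0) :
    IsMinimalGroebnerBasis DegLexLT {p : FreeAlg K ι | ∃ w, IsBasisElement K w p}
      (tIdeal ι {⁅⁅x K 0, x K 1⁆, x K 2⁆}) := by
  refine ⟨⟨fun g ⟨w, hg⟩ => hg.mem_tIdeal h2, fun f hf hf0 => ?_⟩, fun g ⟨w, hg⟩ h => ?_⟩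
  · obtain ⟨w, hw⟩ := exists_isLeadingWord hf0
    by_contra hno
    have hno' : ∀ u p, IsBasisElement K u p → ¬ u <:+: w.toList := fun u p hp hu =>
      hno ⟨p, ⟨u, hp⟩, FreeMonoid.ofList u, w, hp.isLeadingWord, hw, isSubword_ofList_iff.2 hu⟩
    have hav : AvoidsLeads w.toList := ⟨fun a b c h => hno' _ _ (IsBasisElement.triple h),
      fun a b m c d h => hno' _ _ (IsBasisElement.pair h)⟩
    obtain ⟨P, hP⟩ := hav.exists_normalWord
    exact not_normalWord_of_isLeadingWord h2 hf hw P hP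
  · have hlead := hg.isLeadingWord
    have hg0 : g ≠ 0 := by
      rintro rfl
      simpa using hlead.1
    -- Test the reduced set on the removed element: another leading word would have to occur in that
    -- of `g`.
    obtain ⟨p, ⟨⟨u, hp⟩, hpg⟩, u', w', hu', hw', hsub⟩ := h.2 g (hg.mem_tIdeal h2) hg0
    rw [hu'.unique hp.isLeadingWord, hw'.unique hlead, isSubword_ofList_iff] at hsub
    exact hpg (hp.eq_of_infix hg hsub)

end TIdealGroebner

/-- The index set `ι` of the variables is a linear order with a least element and with finite
intervals, i.e. it is order isomorphic to `{1, …, m}` or to `{1, 2, …}`; it has more than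
one element. -/
theorem theorem4p2 (K : Type*) [Field K] (hK : ringChar K ≠ 2)
    (ι : Type*) [LinearOrder ι] [OrderBot ι] [LocallyFiniteOrder ι] [Nontrivial ι] :
    IsMinimalGroebnerBasis DegLexLT
      ({p | ∃ i j : ι, i > j ∧ (p = f₁ K i j ∨ p = f₂ K i j ∨ p = t K i j)} ∪
        {p | ∃ i j k : ι, i > j ∧ j > k ∧
          (p = g₁ K i j k ∨ p = g₂ K i k j ∨ p = u₁ K i j k ∨ p = u₂ K i j k)} ∪
        {p | ∃ i j k : ι, ∃ a : ι → ℕ, i > j ∧ j > k ∧ (p = v₁ K i j k a ∨ p = v₂ K i j k a)} ∪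
        {p | ∃ i j k l : ι, ∃ a : ι → ℕ, i > j ∧ j > k ∧ k > l ∧
          (p = w₁ K i j k l a ∨ p = w₂ K i j k l a)})
      (tIdeal ι {⁅⁅x K 0, x K 1⁆, x K 2⁆}) := by
  rw [basisSet_eq]
  exact isMinimalGroebnerBasis_basisElements (Ring.two_ne_zero hK)
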